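/- **Lemma.** The parameterized problem \textsc{Paired Minimum $s$,$t$-Cut}$(\ell)$ is W[1]-hard. *The problem.* The input consists of a directed acyclic multigraph $D=(U,A)$, two distinct vertices $s,t\in U$, an integer $\ell\in\mathbb{N}$, a pairing $\mathcal{A}$ of the arcs (a partition of $A$ into two-element sets), and a partition of $A$ into (the arc sets of) $2\ell$ arc-disjoint directed paths from $s$ to $t$. The parameter is $\ell$. The question is whether there is an $st$-cut (a set of arcs that meets every directed path from $s$ to $t$) that is the union of at most $\ell$ pairs from $\mathcal{A}$. *W[1]-hardness.* An fpt-reduction from a parameterized problem $P$ to a parameterized problem $Q$ is a map from instances of $P$ to instances of $Q$ that preserves the answer, turns parameter $k$ into a parameter at most $g(k)$, and is computed by a multi-tape Turing machine in time $h(k)\cdot N^{O(1)}$ on instances of length $N$, with computable functions $g,h$. W[1] is the class of parameterized problems that have, for some constant $q$, an fpt-reduction to \textsc{Weighted $q$-CNF-Satisfiability} (given a CNF formula with at most $q$ literals per clause and an integer $k$, the parameter, does the formula have a satisfying assignment with exactly $k$ true variables?). A problem is W[1]-hard if every problem in W[1] has an fpt-reduction to it. -/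

import Mathlib

/-! ### Parameterized problems, fpt-reductions -/

/-- A parameterized decision problem: instances written as strings over a finite alphabet,
a parameter for every instance, and the set of yes-instances. -/
structure ParamProblem where
  /-- the instances (each of them comes with its parameter) -/
  Inst : Type
  /-- the alphabet -/
  Sym : Type
  /-- the alphabet is finite -/
  symFinite : Finite Sym
  /-- the string that a machine gets for an instance -/
  enc : Inst → List Sym
  /-- different instances have different strings -/
  enc_injective : Function.Injective enc
  /-- the parameter of an instance -/
  param : Inst → ℕ
  /-- the yes-instances -/
  Yes : Inst → Prop

/-- There is a (strongly uniform) parameterized many-one reduction, also called fpt-reduction,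
from `P` to `Q`: a map `f` on instances that preserves the answer, whose
output parameter is at most `g` of the input parameter, and that a multi-tape Turing machine
computes in at most `h k * (N + 1) ^ c` steps on every instance of parameter `k` and
encoding length `N`, where `c` is a constant and `g`, `h` are computable functions. -/
def FPTReducible (P Q : ParamProblem) : Prop :=
  ∃ (f : P.Inst → Q.Inst) (M : Turing.TM2ComputableAux P.Sym Q.Sym) (g h : ℕ → ℕ) (c : ℕ),
    Computable g ∧ Computable h ∧
    (∀ x, P.Yes x ↔ Q.Yes (f x)) ∧
    (∀ x, Q.param (f x) ≤ g (P.param x)) ∧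
    (∀ x, Nonempty (Turing.TM2OutputsInTime M.tm
      ((P.enc x).map M.inputAlphabet.symm)
      (some ((Q.enc (f x)).map M.outputAlphabet.symm))
      (h (P.param x) * ((P.enc x).length + 1) ^ c)))

/-! ### Strings for lists of natural numbers -/

/-- Every number is written in unary and closed by the symbol `false`. -/
def encodeNats (l : List ℕ) : List Bool :=
  l.flatMap fun n => List.replicate n true ++ [false]

/-- A list preceded by its length. -/
def withLength {α : Type} (code : α → List ℕ) (l : List α) : List ℕ :=
  l.length :: l.flatMap code

/-- No code word is a proper prefix of another one, and code words determine their source. -/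
def IsPrefixCode {α β : Type} (code : α → List β) : Prop :=
  ∀ a b x y, code a ++ x = code b ++ y → a = b ∧ x = y

theorem IsPrefixCode.flatMap_append {α β : Type} {code : α → List β} (hc : IsPrefixCode code) :
    ∀ (l l' : List α) (x y : List β), l.length = l'.length →
      l.flatMap code ++ x = l'.flatMap code ++ y → l = l' ∧ x = y
  | [], [], x, y, _, h => ⟨rfl, by simpa using h⟩
  | [], _ :: _, _, _, hl, _ => by simp at hl
  | _ :: _, [], _, _, hl, _ => by simp at hl
  | a :: l, b :: l', x, y, hl, h => by
      simp only [List.flatMap_cons, List.append_assoc] at h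
      obtain ⟨rfl, h₁⟩ := hc _ _ _ _ h
      obtain ⟨rfl, h₂⟩ := hc.flatMap_append l l' x y (by simpa using hl) h₁
      exact ⟨rfl, h₂⟩

theorem IsPrefixCode.flatMap_injective {α β : Type} {code : α → List β} (hc : IsPrefixCode code)
    (hne : ∀ a, code a ≠ []) : Function.Injective fun l : List α => l.flatMap code := by
  intro l
  induction l with
  | nil =>
      intro l' h
      cases l' with
      | nil => rfl
      | cons b l' => simp [hne b] at h
  | cons a l ih =>
      intro l' h
      cases l' with
      | nil => simp [hne a] at h
      | cons b l' =>
          simp only [List.flatMap_cons] at h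
          obtain ⟨rfl, h₁⟩ := hc _ _ _ _ h
          rw [ih h₁]

theorem IsPrefixCode.withLength {α : Type} {code : α → List ℕ} (hc : IsPrefixCode code) :
    IsPrefixCode (withLength code) := by
  intro l l' x y h
  simp only [_root_.withLength, List.cons_append, List.cons.injEq] at h
  exact hc.flatMap_append l l' x y h.1 h.2

theorem isPrefixCode_unary : IsPrefixCode fun n : ℕ => List.replicate n true ++ [false] := by
  intro a
  induction a with
  | zero => intro b x y h; cases b <;> simp_all [List.replicate_succ]
  | succ a ih =>
      intro b x y h
      cases b with
      | zero => simp [List.replicate_succ] at h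
      | succ b =>
          simp only [List.replicate_succ, List.cons_append, List.cons.injEq, true_and] at h
          obtain ⟨rfl, h₁⟩ := ih b x y h
          exact ⟨rfl, h₁⟩

theorem encodeNats_injective : Function.Injective encodeNats :=
  isPrefixCode_unary.flatMap_injective (by simp)

/-- The number `i` as a list with one entry. -/
def finCode {n : ℕ} (i : Fin n) : List ℕ := [(i : ℕ)]

theorem isPrefixCode_finCode {n : ℕ} : IsPrefixCode (finCode (n := n)) := by
  intro a b x y h
  simpa [finCode, Fin.val_inj] using h

/-! ### Weighted `q`-CNF satisfiability and the class W[1] -/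

/-- A propositional formula in conjunctive normal form with at most `q` literals in every clause,
and a target weight. The literal `(v, true)` is the variable `v`, the literal `(v, false)` is its
negation. -/
structure WeightedCNF (q : ℕ) where
  numVars : ℕ
  clauses : List (List (Fin numVars × Bool))
  width : ∀ C ∈ clauses, C.length ≤ q
  weight : ℕ

namespace WeightedCNF

variable {q : ℕ}

/-- The assignment that makes exactly the variables in `S` true satisfies the formula. -/
def SatisfiedBy (φ : WeightedCNF q) (S : Finset (Fin φ.numVars)) : Prop :=
  ∀ C ∈ φ.clauses, ∃ L ∈ C, (L.2 = true ↔ L.1 ∈ S)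

/-- Some satisfying assignment sets exactly `weight` variables to true. -/
def HasWeightedSolution (φ : WeightedCNF q) : Prop :=
  ∃ S : Finset (Fin φ.numVars), S.card = φ.weight ∧ φ.SatisfiedBy S

def literalCode {n : ℕ} (L : Fin n × Bool) : List ℕ := [(L.1 : ℕ), L.2.toNat]

def toNats (φ : WeightedCNF q) : List ℕ :=
  φ.numVars :: φ.weight :: withLength (withLength literalCode) φ.clauses

theorem isPrefixCode_literalCode {n : ℕ} : IsPrefixCode (literalCode (n := n)) := by
  rintro ⟨v, b⟩ ⟨v', b'⟩ x y h
  simp only [literalCode, List.cons_append, List.nil_append, List.cons.injEq, Fin.val_inj] at h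
  obtain ⟨rfl, hb, rfl⟩ := h
  cases b <;> cases b' <;> simp_all

theorem toNats_injective : Function.Injective (toNats (q := q)) := by
  rintro ⟨n, cs, hw, k⟩ ⟨n', cs', hw', k'⟩ h
  simp only [toNats, List.cons.injEq] at h
  obtain ⟨rfl, rfl, h⟩ := h
  obtain ⟨rfl, -⟩ := isPrefixCode_literalCode.withLength.withLength cs cs' [] [] (by simpa using h)
  rfl

end WeightedCNF

/-- Weighted `q`-CNF satisfiability, parameterized by the weight. -/
def weightedCNFProblem (q : ℕ) : ParamProblem where
  Inst := WeightedCNF q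
  Sym := Bool
  symFinite := inferInstance
  enc φ := encodeNats φ.toNats
  enc_injective := encodeNats_injective.comp WeightedCNF.toNats_injective
  param φ := φ.weight
  Yes φ := φ.HasWeightedSolution

/-- The class W[1]: the problems with an fpt-reduction to weighted `q`-CNF satisfiability
for some constant `q`. -/
def InW1 (P : ParamProblem) : Prop := ∃ q : ℕ, FPTReducible P (weightedCNFProblem q)

/-- A problem is W[1]-hard if every problem in W[1] has an fpt-reduction to it. -/
def W1Hard (Q : ParamProblem) : Prop := ∀ P : ParamProblem, InW1 P → FPTReducible P Q

/-! ### Paired minimum cut -/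

/-- A directed multigraph with vertex set `V` and arc set `A`. -/
structure DirMultigraph (V A : Type) where
  src : A → V
  tgt : A → V

namespace DirMultigraph

variable {V A : Type}

/-- `D.IsWalk p u v`: the arcs in `p`, in this order, form a directed walk from `u` to `v`. -/
def IsWalk (D : DirMultigraph V A) : List A → V → V → Prop
  | [], u, v => u = v
  | a :: p, u, v => D.src a = u ∧ D.IsWalk p (D.tgt a) v

/-- There is no directed cycle. (So directed walks and directed paths are the same thing.) -/
def IsAcyclic (D : DirMultigraph V A) : Prop :=
  ∀ (v : V) (p : List A), D.IsWalk p v v → p = []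

/-- Every directed path from `s` to `t` contains an arc of `B`. -/
def IsCut (D : DirMultigraph V A) (s t : V) (B : Finset A) : Prop :=
  ∀ p : List A, D.IsWalk p s t → ∃ a ∈ p, a ∈ B

end DirMultigraph

/-- An instance of the paired minimum `s`,`t`-cut problem. Vertices and arcs are numbered. -/
structure PairedCutInstance where
  numVerts : ℕ
  numArcs : ℕ
  graph : DirMultigraph (Fin numVerts) (Fin numArcs)
  acyclic : graph.IsAcyclic
  s : Fin numVerts
  t : Fin numVerts
  s_ne_t : s ≠ t
  ℓ : ℕ
  /-- the arc that an arc is paired with -/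
  mate : Fin numArcs → Fin numArcs
  mate_mate : ∀ a, mate (mate a) = a
  mate_ne : ∀ a, mate a ≠ a
  /-- the `2ℓ` paths, each given by the list of its arcs -/
  path : Fin (2 * ℓ) → List (Fin numArcs)
  path_isWalk : ∀ i, graph.IsWalk (path i) s t
  /-- the paths partition the set of arcs -/
  path_partition : ∀ a, ∃! i, a ∈ path i

namespace PairedCutInstance

/-- The set of all pairs of arcs. -/
def pairs (I : PairedCutInstance) : Finset (Finset (Fin I.numArcs)) :=
  Finset.univ.image fun a => {a, I.mate a}

/-- Some `st`-cut is the union of at most `ℓ` of the pairs. -/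
def HasPairedCut (I : PairedCutInstance) : Prop :=
  ∃ F : Finset (Finset (Fin I.numArcs)),
    F ⊆ I.pairs ∧ F.card ≤ I.ℓ ∧ I.graph.IsCut I.s I.t (F.biUnion id)

def toNats (I : PairedCutInstance) : List ℕ :=
  [I.numVerts, I.numArcs, (I.s : ℕ), (I.t : ℕ), I.ℓ] ++
    ((List.ofFn I.graph.src).flatMap finCode ++
    ((List.ofFn I.graph.tgt).flatMap finCode ++
    ((List.ofFn I.mate).flatMap finCode ++
    (List.ofFn I.path).flatMap (withLength finCode))))

theorem toNats_injective : Function.Injective toNats := by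
  rintro ⟨n, m, ⟨src, tgt⟩, h1, s, t, h2, l, mate, h3, h4, path, h5, h6⟩
    ⟨n', m', ⟨src', tgt'⟩, h1', s', t', h2', l', mate', h3', h4', path', h5', h6'⟩ h
  simp only [toNats, List.cons_append, List.nil_append, List.cons.injEq] at h
  obtain ⟨rfl, rfl, hs, ht, rfl, h⟩ := h
  obtain rfl := Fin.val_injective hs
  obtain rfl := Fin.val_injective ht
  obtain ⟨e₁, k₁⟩ := isPrefixCode_finCode.flatMap_append (List.ofFn src) (List.ofFn src')
    _ _ (by simp) h
  obtain ⟨e₂, k₂⟩ := isPrefixCode_finCode.flatMap_append (List.ofFn tgt) (List.ofFn tgt')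
    _ _ (by simp) k₁
  obtain ⟨e₃, k₃⟩ := isPrefixCode_finCode.flatMap_append (List.ofFn mate) (List.ofFn mate')
    _ _ (by simp) k₂
  obtain ⟨e₄, -⟩ := isPrefixCode_finCode.withLength.flatMap_append (List.ofFn path)
    (List.ofFn path') [] [] (by simp) (by simpa using k₃)
  obtain rfl := List.ofFn_injective e₁
  obtain rfl := List.ofFn_injective e₂
  obtain rfl := List.ofFn_injective e₃
  obtain rfl := List.ofFn_injective e₄
  rfl

end PairedCutInstance

/-- Paired minimum `s`,`t`-cut, parameterized by `ℓ`. -/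
def pairedMinCutProblem : ParamProblem where
  Inst := PairedCutInstance
  Sym := Bool
  symFinite := inferInstance
  enc I := encodeNats I.toNats
  enc_injective := encodeNats_injective.comp PairedCutInstance.toNats_injective
  param I := I.ℓ
  Yes I := I.HasPairedCut

/-! The reduction starts from weighted `q`-CNF satisfiability with `n` variables and weight `k`, and
passes through a grid of binary constraints. An assignment of weight `k` is an increasing sequence
`x 0 < ... < x (k+1)`: its true variables, numbered from `1`, between the sentinels `0` and `n+1`. A
literal is false iff some consecutive pair `(x j, x (j+1))` shows it: the variable of a positive
literal lies strictly inside the gap, that of a negative literal equals `x j`. So `q` pairs suffice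
to show that a clause is false. For every list `τ` of `q+1` indices a variable `y τ` records the
`q+1` pairs at these indices. That `y τ` agrees with `x i` and falsifies no clause is a condition on
these two values alone (`Compatible`). There are `(k+2)(k+1)^(q+1)` constraints, and for fixed `q`
the domains are polynomial in `n`.

Every constraint `(i, τ)` gets a left and a right path, so `ℓ` is the number of constraints. A
position on either path codes a pair of values `(v, w)` and a parity, with `v` as leading digit on
the left and `w` on the right. Left paths with the same `i` share the vertices at which `v` changes,
right paths with the same `τ` those at which `w` changes. Arcs of a compatible `(v, w)` are paired
across the two paths, all others with an arc of their own path. Since `ℓ` pairs have at most `2ℓ`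
arcs and must hit `2ℓ` arc-disjoint paths, a solution cuts each path exactly once; hence its pairs
go across and both paths of a constraint choose the same compatible `(v, w)`. Paths that share
vertices must be cut in the same segment, since otherwise a walk escapes by changing paths at a
shared vertex; conversely, consistent choices give a cut (`hasPairedCut_iff`,
`hasPairedCut_toPairedCut_iff`).

The rest is running time. Arithmetic expressions with bounded sums and capped iteration compile to
structured programs of polynomial running time (`exec_compile`), and these to stack machines on
unary numbers (`exec_code`). The reduction is such a program (`eval_reductionProg`), and it is
appended to the machine of an arbitrary fpt-reduction to weighted satisfiability
(`composed_outputs`, `trans_listProg`). -/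

/-! ### Structured programs on stacks of natural numbers -/

/-- Programs on finitely many stacks of natural numbers. -/
inductive StackProg (K : Type) : Type
  | skip : StackProg K
  | zero : K → StackProg K
  | inc : K → StackProg K
  | dec : K → StackProg K
  | seq : StackProg K → StackProg K → StackProg K
  /-- repeat the body as often as the top number says, and remove that number -/
  | loop : K → StackProg K → StackProg K
  /-- repeat the body while the stack is not empty -/
  | whileNE : K → StackProg K → StackProg K
  | ifNE : K → StackProg K → StackProg K → StackProg K

namespace StackProg

variable {K : Type}

/-- The program takes at most `t` steps from the first state to the second one. -/
inductive Exec [DecidableEq K] : StackProg K → (K → List ℕ) → ℕ → (K → List ℕ) → Prop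
  | skip (s) : Exec skip s 1 s
  | zero (k s) : Exec (zero k) s 1 (Function.update s k (0 :: s k))
  | inc (k s) (n : ℕ) (l) (h : s k = n :: l) :
      Exec (inc k) s 1 (Function.update s k ((n + 1) :: l))
  | dec (k s) (n : ℕ) (l) (h : s k = n :: l) :
      Exec (dec k) s 1 (Function.update s k ((n - 1) :: l))
  | seq {p q s₁ s₂ s₃} {t₁ t₂ : ℕ} (h₁ : Exec p s₁ t₁ s₂) (h₂ : Exec q s₂ t₂ s₃) :
      Exec (seq p q) s₁ (t₁ + t₂) s₃
  | loop_zero (k p s l) (h : s k = 0 :: l) : Exec (loop k p) s 1 (Function.update s k l)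
  | loop_succ {k p s n l s₁ s₂} {t₁ t₂ : ℕ} (h : s k = (n + 1) :: l)
      (h₁ : Exec p (Function.update s k (n :: l)) t₁ s₁) (h₂ : Exec (loop k p) s₁ t₂ s₂) :
      Exec (loop k p) s (1 + t₁ + t₂) s₂
  | while_nil (k p s) (h : s k = []) : Exec (whileNE k p) s 1 s
  | while_cons {k p s s₁ s₂} {t₁ t₂ : ℕ} (h : s k ≠ [])
      (h₁ : Exec p s t₁ s₁) (h₂ : Exec (whileNE k p) s₁ t₂ s₂) :
      Exec (whileNE k p) s (1 + t₁ + t₂) s₂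
  | if_nil {k p q s s₁} {t : ℕ} (h : s k = []) (h₁ : Exec q s t s₁) :
      Exec (ifNE k p q) s (1 + t) s₁
  | if_cons {k p q s s₁} {t : ℕ} (h : s k ≠ []) (h₁ : Exec p s t s₁) :
      Exec (ifNE k p q) s (1 + t) s₁
  | mono {p s s₁} {t t' : ℕ} (h : t ≤ t') (h₁ : Exec p s t s₁) : Exec p s t' s₁

/-- The labels of the compiled program. -/
def Lab : StackProg K → Type
  | skip => Unit
  | zero _ => Unit
  | inc _ => Unit
  | dec _ => Unit
  | seq p q => Lab p ⊕ Lab q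
  | loop _ p => Option (Lab p)
  | whileNE _ p => Option (Lab p)
  | ifNE _ p q => Option (Lab p ⊕ Lab q)

instance Lab.finite : ∀ p : StackProg K, Finite (Lab p)
  | skip => inferInstanceAs (Finite Unit)
  | zero _ => inferInstanceAs (Finite Unit)
  | inc _ => inferInstanceAs (Finite Unit)
  | dec _ => inferInstanceAs (Finite Unit)
  | seq p q => by
      have := Lab.finite p
      have := Lab.finite q
      exact inferInstanceAs (Finite (Lab p ⊕ Lab q))
  | loop _ p => by
      have := Lab.finite p
      exact inferInstanceAs (Finite (Option (Lab p)))
  | whileNE _ p => by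
      have := Lab.finite p
      exact inferInstanceAs (Finite (Option (Lab p)))
  | ifNE _ p q => by
      have := Lab.finite p
      have := Lab.finite q
      exact inferInstanceAs (Finite (Option (Lab p ⊕ Lab q)))

/-- The label at which the compiled program starts. -/
def entry : (p : StackProg K) → Lab p
  | skip => ()
  | zero _ => ()
  | inc _ => ()
  | dec _ => ()
  | seq p _ => Sum.inl (entry p)
  | loop _ _ => none
  | whileNE _ _ => none
  | ifNE _ _ _ => none

end StackProg

/-! ### Compilation of structured programs into stack machines -/

/-- A stack machine with a Boolean stack for every `k : K`, and a register for one symbol. -/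
structure StackLayout (K K' : Type) (Γ : K' → Type) where
  stack : K → K'
  stack_injective : Function.Injective stack
  symbol : ∀ k, Γ (stack k) ≃ Bool

namespace StackProg

open Turing

variable {K K' : Type} {Γ : K' → Type}

/-- The function bodies of the compiled program; `lab` names the labels, and the program goes to
the label `exit` in the end. -/
def code (Y : StackLayout K K' Γ) (σ : Type) {Λ : Type} :
    (p : StackProg K) → (Lab p → Λ) → Λ → Lab p → TM2.Stmt Γ Λ (σ × Option Bool)
  | skip, _, exit, _ => .goto fun _ => exit
  | zero k, _, exit, _ => .push (Y.stack k) (fun _ => (Y.symbol k).symm false) (.goto fun _ => exit)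
  | inc k, _, exit, _ => .push (Y.stack k) (fun _ => (Y.symbol k).symm true) (.goto fun _ => exit)
  -- If the number is `0`, the popped symbol is its end mark; it is put back, so that `0` stays `0`.
  | dec k, _, exit, _ =>
      .pop (Y.stack k) (fun v x => (v.1, x.map (Y.symbol k)))
        (.branch (fun v => v.2 == some true) (.goto fun _ => exit)
          (.push (Y.stack k) (fun _ => (Y.symbol k).symm false) (.goto fun _ => exit)))
  | seq p q, lab, exit, l =>
      Sum.casesOn l (code Y σ p (fun l => lab (Sum.inl l)) (lab (Sum.inr (entry q))))
        (code Y σ q (fun l => lab (Sum.inr l)) exit)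
  | loop k p, lab, exit, l =>
      Option.casesOn l
        (.pop (Y.stack k) (fun v x => (v.1, x.map (Y.symbol k)))
          (.branch (fun v => v.2 == some true) (.goto fun _ => lab (some (entry p)))
            (.goto fun _ => exit)))
        (code Y σ p (fun l => lab (some l)) (lab none))
  | whileNE k p, lab, exit, l =>
      Option.casesOn l
        (.peek (Y.stack k) (fun v x => (v.1, x.map (Y.symbol k)))
          (.branch (fun v => v.2.isSome) (.goto fun _ => lab (some (entry p)))
            (.goto fun _ => exit)))
        (code Y σ p (fun l => lab (some l)) (lab none))
  | ifNE k p q, lab, exit, l =>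
      Option.casesOn l
        (.peek (Y.stack k) (fun v x => (v.1, x.map (Y.symbol k)))
          (.branch (fun v => v.2.isSome) (.goto fun _ => lab (some (Sum.inl (entry p))))
            (.goto fun _ => lab (some (Sum.inr (entry q))))))
        fun l => Sum.casesOn l (code Y σ p (fun l => lab (some (Sum.inl l))) exit)
          (code Y σ q (fun l => lab (some (Sum.inr l))) exit)

end StackProg

/-- `b` is reached from `a` in at most `m` steps. -/
def ReachesIn {C : Type} (f : C → Option C) (a b : C) (m : ℕ) : Prop :=
  Nonempty (StateTransition.EvalsToInTime f a (some b) m)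

namespace ReachesIn

variable {C : Type} {f : C → Option C} {a b c : C} {m n : ℕ}

theorem single (h : f a = some b) : ReachesIn f a b 1 := ⟨⟨⟨1, by simpa [flip] using h⟩, le_rfl⟩⟩

theorem trans (h₁ : ReachesIn f a b m) (h₂ : ReachesIn f b c n) : ReachesIn f a c (m + n) := by
  obtain ⟨h₁⟩ := h₁
  obtain ⟨h₂⟩ := h₂
  rw [add_comm]
  exact ⟨h₁.trans _ _ _ _ _ _ h₂⟩

theorem mono (h : ReachesIn f a b m) (hmn : m ≤ n) : ReachesIn f a b n := by
  obtain ⟨h⟩ := h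
  exact ⟨⟨h.toEvalsTo, h.steps_le_m.trans hmn⟩⟩

end ReachesIn

theorem encodeNats_cons (n : ℕ) (l : List ℕ) :
    encodeNats (n :: l) = List.replicate n true ++ false :: encodeNats l := by
  simp [encodeNats]

theorem encodeNats_zero_cons (l : List ℕ) : encodeNats (0 :: l) = false :: encodeNats l := by
  simp [encodeNats_cons]

theorem encodeNats_succ_cons (n : ℕ) (l : List ℕ) :
    encodeNats ((n + 1) :: l) = true :: encodeNats (n :: l) := by
  simp [encodeNats_cons, List.replicate_succ]

namespace StackLayout

variable {K K' : Type} {Γ : K' → Type}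

/-- The Boolean stacks hold the numbers of the state `s`, the other stacks are those of `S₀`. -/
structure Holds (Y : StackLayout K K' Γ) (S₀ : ∀ k, List (Γ k)) (s : K → List ℕ)
    (S : ∀ k, List (Γ k)) : Prop where
  stack : ∀ k, S (Y.stack k) = (encodeNats (s k)).map (Y.symbol k).symm
  other : ∀ k', (∀ k, Y.stack k ≠ k') → S k' = S₀ k'

theorem Holds.update [DecidableEq K] [DecidableEq K'] {Y : StackLayout K K' Γ}
    {S₀ S : ∀ k, List (Γ k)} {s : K → List ℕ} (h : Y.Holds S₀ s S) (k : K) (l : List ℕ)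
    (L : List (Γ (Y.stack k))) (hL : L = (encodeNats l).map (Y.symbol k).symm) :
    Y.Holds S₀ (Function.update s k l) (Function.update S (Y.stack k) L) := by
  refine ⟨fun k₁ => ?_, fun k' hk' => ?_⟩
  · by_cases hk : k₁ = k
    · subst hk; simp [hL]
    · rw [Function.update_of_ne hk, Function.update_of_ne (fun e => hk (Y.stack_injective e)),
        h.stack]
  · rw [Function.update_of_ne (hk' k).symm, h.other k' hk']

end StackLayout

namespace StackProg

open Turing

variable {K K' : Type} {Γ : K' → Type} [DecidableEq K] [DecidableEq K']

/-- Induction on the run. In unary, every primitive changes at most one symbol, hence costs one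
machine step; the exit of a part is the entry of what follows it, which is the loop test in case of
a loop body. The first register component is never changed, so the state of a preceding machine
survives there. -/
theorem exec_code (Y : StackLayout K K' Γ) {σ Λ : Type} (S₀ : ∀ k, List (Γ k))
    (M : Λ → TM2.Stmt Γ Λ (σ × Option Bool)) {p : StackProg K} {s s' : K → List ℕ} {t : ℕ}
    (h : Exec p s t s') (lab : Lab p → Λ) (exit : Λ)
    (hM : ∀ l, M (lab l) = code Y σ p lab exit l) (v : σ × Option Bool) (S : ∀ k, List (Γ k))
    (hS : Y.Holds S₀ s S) :
    ∃ (x : Option Bool) (S' : ∀ k, List (Γ k)), Y.Holds S₀ s' S' ∧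
      ReachesIn (TM2.step M) ⟨some (lab (entry p)), v, S⟩ ⟨some exit, (v.1, x), S'⟩ t := by
  induction h generalizing exit v S with
  | skip s =>
      refine ⟨v.2, S, hS, .single ?_⟩
      rw [TM2.step, hM]; simp [code]
  | zero k s =>
      refine ⟨v.2, _, hS.update k (0 :: s k) ((Y.symbol k).symm false :: S (Y.stack k)) ?_,
        .single ?_⟩
      · rw [hS.stack, encodeNats_zero_cons, List.map_cons]
      · rw [TM2.step, hM]; simp [code]
  | inc k s n l h =>
      refine ⟨v.2, _, hS.update k ((n + 1) :: l) ((Y.symbol k).symm true :: S (Y.stack k)) ?_,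
        .single ?_⟩
      · rw [hS.stack, h, encodeNats_succ_cons, List.map_cons]
      · rw [TM2.step, hM]; simp [code]
  | dec k s n l h =>
      have hk := hS.stack k
      rw [h] at hk
      cases n with
      | zero =>
          rw [encodeNats_zero_cons, List.map_cons] at hk
          refine ⟨some false, _, hS.update k (0 :: l) (S (Y.stack k)) ?_, .single ?_⟩
          · rw [hk, encodeNats_zero_cons, List.map_cons]
          · rw [TM2.step, hM]; simp [code, hk]
      | succ n =>
          rw [encodeNats_succ_cons, List.map_cons] at hk
          refine ⟨some true, _, hS.update k (n :: l) (S (Y.stack k)).tail ?_, .single ?_⟩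
          · rw [hk, List.tail_cons]
          · rw [TM2.step, hM]; simp [code, hk]
  | @seq p q s₁ s₂ s₃ t₁ t₂ _ _ ih₁ ih₂ =>
      obtain ⟨x₁, S₁, hS₁, r₁⟩ := ih₁ (fun l => lab (Sum.inl l)) (lab (Sum.inr (entry q)))
        (fun l => hM (Sum.inl l)) v S hS
      obtain ⟨x₂, S₂, hS₂, r₂⟩ := ih₂ (fun l => lab (Sum.inr l)) exit
        (fun l => hM (Sum.inr l)) (v.1, x₁) S₁ hS₁
      exact ⟨x₂, S₂, hS₂, r₁.trans r₂⟩
  | loop_zero k p s l h =>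
      have hk := hS.stack k
      rw [h, encodeNats_zero_cons, List.map_cons] at hk
      refine ⟨some false, _, hS.update k l (S (Y.stack k)).tail (by rw [hk, List.tail_cons]),
        .single ?_⟩
      rw [TM2.step, hM]; simp [entry, code, hk]
  | @loop_succ k p s n l s₁ s₂ t₁ t₂ h _ _ ih₁ ih₂ =>
      have hk := hS.stack k
      rw [h, encodeNats_succ_cons, List.map_cons] at hk
      obtain ⟨x₁, S₁, hS₁, r₁⟩ := ih₁ (fun l => lab (some l)) (lab none)
        (fun l => hM (some l)) (v.1, some true) _
        (hS.update k (n :: l) (S (Y.stack k)).tail (by rw [hk, List.tail_cons]))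
      obtain ⟨x₂, S₂, hS₂, r₂⟩ := ih₂ lab exit hM (v.1, x₁) S₁ hS₁
      refine ⟨x₂, S₂, hS₂, ((ReachesIn.single ?_).trans r₁).trans r₂⟩
      rw [TM2.step, hM]; simp [entry, code, hk]
  | while_nil k p s h =>
      have hk := hS.stack k
      rw [h] at hk
      refine ⟨none, S, hS, .single ?_⟩
      rw [TM2.step, hM]; simp [entry, code, hk, encodeNats]
  | @while_cons k p s s₁ s₂ t₁ t₂ h _ _ ih₁ ih₂ =>
      have hk := hS.stack k
      -- Even the number `0` occupies a symbol, so one peek tells whether the stack is empty.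
      have hne : (encodeNats (s k)).head?.isSome := by
        obtain ⟨n, l, e⟩ := List.exists_cons_of_ne_nil h
        rw [e, encodeNats_cons]
        cases n <;> simp [List.replicate_succ]
      obtain ⟨x₁, S₁, hS₁, r₁⟩ := ih₁ (fun l => lab (some l)) (lab none)
        (fun l => hM (some l)) (v.1, (S (Y.stack k)).head?.map (Y.symbol k)) S hS
      obtain ⟨x₂, S₂, hS₂, r₂⟩ := ih₂ lab exit hM (v.1, x₁) S₁ hS₁
      refine ⟨x₂, S₂, hS₂, ((ReachesIn.single ?_).trans r₁).trans r₂⟩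
      rw [TM2.step, hM]; simp [entry, code, hk, hne]
  | @if_nil k p q s s₁ t h _ ih =>
      have hk := hS.stack k
      rw [h] at hk
      obtain ⟨x₁, S₁, hS₁, r₁⟩ := ih (fun l => lab (some (Sum.inr l))) exit
        (fun l => hM (some (Sum.inr l))) (v.1, none) S hS
      refine ⟨x₁, S₁, hS₁, (ReachesIn.single ?_).trans r₁⟩
      rw [TM2.step, hM]; simp [entry, code, hk, encodeNats]
  | @if_cons k p q s s₁ t h _ ih =>
      have hk := hS.stack k
      have hne : (encodeNats (s k)).head?.isSome := by
        obtain ⟨n, l, e⟩ := List.exists_cons_of_ne_nil h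
        rw [e, encodeNats_cons]
        cases n <;> simp [List.replicate_succ]
      obtain ⟨x₁, S₁, hS₁, r₁⟩ := ih (fun l => lab (some (Sum.inl l))) exit
        (fun l => hM (some (Sum.inl l))) (v.1, (S (Y.stack k)).head?.map (Y.symbol k)) S hS
      refine ⟨x₁, S₁, hS₁, (ReachesIn.single ?_).trans r₁⟩
      rw [TM2.step, hM]; simp [entry, code, hk, hne]
  | mono hle _ ih =>
      obtain ⟨x, S₁, hS₁, r⟩ := ih lab exit hM v S hS
      exact ⟨x, S₁, hS₁, r.mono hle⟩

end StackProg

/-! ### A machine followed by a program -/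

/-- The stacks of the arithmetic programs: input, environment, operands, temporary numbers,
loop counters and output. -/
inductive Stk
  | input | env | opnd | temp | ctr | out
  deriving DecidableEq

instance : Fintype Stk :=
  ⟨{.input, .env, .opnd, .temp, .ctr, .out}, by rintro (_ | _) <;> decide⟩

namespace Turing

section Lift

variable {K Λ σ : Type} {Γ : K → Type} (p : StackProg Stk)

/-- The stacks of the composed machine. -/
@[reducible] def composedSymbol (Γ : K → Type) : K ⊕ Stk → Type
  | .inl k => Γ k
  | .inr _ => Bool

/-- The labels of the composed machine. -/
abbrev ComposedLabel (Λ : Type) (p : StackProg Stk) : Type := Λ ⊕ (p.Lab ⊕ Unit)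

/-- The statements of a machine in the composed machine, which goes on with `p` on halting. -/
def liftStmt : TM2.Stmt Γ Λ σ →
    TM2.Stmt (composedSymbol Γ) (ComposedLabel Λ p) (σ × Option Bool)
  | .push k f q => .push (Sum.inl k) (fun v => f v.1) (liftStmt q)
  | .peek k f q => .peek (Sum.inl k) (fun v x => (f v.1 x, v.2)) (liftStmt q)
  | .pop k f q => .pop (Sum.inl k) (fun v x => (f v.1 x, v.2)) (liftStmt q)
  | .load f q => .load (fun v => (f v.1, v.2)) (liftStmt q)
  | .branch f q₁ q₂ => .branch (fun v => f v.1) (liftStmt q₁) (liftStmt q₂)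
  | .goto f => .goto fun v => Sum.inl (f v.1)
  | .halt => .goto fun _ => Sum.inr (Sum.inl p.entry)

/-- The stacks of a machine, with empty stacks for the program. -/
def liftStk (S : ∀ k, List (Γ k)) : ∀ k, List (composedSymbol Γ k)
  | .inl k => S k
  | .inr _ => []

/-- The configurations of a machine in the composed machine. -/
def liftCfg (c : TM2.Cfg Γ Λ σ) :
    TM2.Cfg (composedSymbol Γ) (ComposedLabel Λ p) (σ × Option Bool) where
  -- A halted configuration corresponds to the start of `p`.
  l := some (c.l.elim (Sum.inr (Sum.inl p.entry)) Sum.inl)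
  var := (c.var, none)
  stk := liftStk c.stk

variable [DecidableEq K]

theorem update_liftStk (S : ∀ k, List (Γ k)) (k : K) (L : List (Γ k)) :
    Function.update (liftStk S) (Sum.inl k) L = liftStk (Function.update S k L) := by
  funext k'
  rcases k' with k' | k'
  · by_cases h : k' = k
    · subst h
      exact (Function.update_self ..).trans (Function.update_self (f := S) ..).symm
    · have h₁ : (Sum.inl k' : K ⊕ Stk) ≠ Sum.inl k := by simpa using h
      have h₂ : Function.update S k L k' = S k' := Function.update_of_ne h ..
      exact (Function.update_of_ne h₁ ..).trans h₂.symm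
  · exact Function.update_of_ne (by simp) ..

/-- The translation touches neither the new stacks nor the new register component, and replaces
halting by a jump. So the time bound of the machine carries over unchanged. -/
theorem stepAux_liftStmt (q : TM2.Stmt Γ Λ σ) (v : σ) (S : ∀ k, List (Γ k)) :
    TM2.stepAux (liftStmt p q) (v, none) (liftStk S) = liftCfg p (TM2.stepAux q v S) := by
  induction q generalizing v S with
  | push k f q ih =>
      change TM2.stepAux (liftStmt p q) (v, none)
        (Function.update (liftStk S) (Sum.inl k) (f v :: S k)) = _
      rw [update_liftStk]
      exact ih _ _
  | peek k f q ih => exact ih _ _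
  | pop k f q ih =>
      change TM2.stepAux (liftStmt p q) (f v (S k).head?, none)
        (Function.update (liftStk S) (Sum.inl k) (S k).tail) = _
      rw [update_liftStk]
      exact ih _ _
  | load f q ih => exact ih _ _
  | branch f q₁ q₂ ih₁ ih₂ =>
      rw [liftStmt, TM2.stepAux, TM2.stepAux, ih₁, ih₂]
      change cond (f v) _ _ = _
      cases f v <;> rfl
  | goto f => rfl
  | halt => rfl

end Lift

variable {α : Type} (M : TM2ComputableAux α Bool) (p : StackProg Stk)

/-- The program reads its input from the output stack of `M`. -/
def composedLayout : StackLayout Stk (M.tm.K ⊕ Stk) (composedSymbol M.tm.Γ) where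
  stack
    | .input => Sum.inl M.tm.k₁
    | x => Sum.inr x
  stack_injective := by
    rintro (_ | _) (_ | _) h <;> simp at h ⊢
  symbol
    | .input => M.outputAlphabet
    | .env => Equiv.refl Bool
    | .opnd => Equiv.refl Bool
    | .temp => Equiv.refl Bool
    | .ctr => Equiv.refl Bool
    | .out => Equiv.refl Bool

/-- The code of the composed machine. -/
def composedCode : ComposedLabel M.tm.Λ p →
    TM2.Stmt (composedSymbol M.tm.Γ) (ComposedLabel M.tm.Λ p) (M.tm.σ × Option Bool)
  | Sum.inl l => liftStmt p (M.tm.m l)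
  | Sum.inr (Sum.inl l) =>
      p.code (composedLayout M) M.tm.σ (fun l => Sum.inr (Sum.inl l)) (Sum.inr (Sum.inr ())) l
  | Sum.inr (Sum.inr _) => .load (fun v => (v.1, none)) .halt

theorem step_liftCfg {c c' : M.tm.Cfg} (h : M.tm.step c = some c') :
    TM2.step (composedCode M p) (liftCfg p c) = some (liftCfg p c') := by
  obtain ⟨l, v, S⟩ := c
  cases l with
  | none => cases h
  | some l =>
      obtain rfl : TM2.stepAux (M.tm.m l) v S = c' := Option.some.inj h
      exact congrArg some (stepAux_liftStmt p (M.tm.m l) v S)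

theorem reachesIn_liftCfg {c c' : M.tm.Cfg} {n : ℕ} (h : ReachesIn M.tm.step c c' n) :
    ReachesIn (TM2.step (composedCode M p)) (liftCfg p c) (liftCfg p c') n := by
  obtain ⟨⟨⟨m, hm⟩, hmn⟩⟩ := h
  refine ⟨⟨⟨m, ?_⟩, hmn⟩⟩
  clear hmn
  induction m generalizing c with
  | zero =>
      simp only [Function.iterate_zero, id_eq, Option.some.injEq] at hm ⊢
      rw [hm]
  | succ m ih =>
      rw [Function.iterate_succ_apply] at hm ⊢
      rcases hs : M.tm.step c with _ | c₁
      -- A run that stops early stays at `none` and cannot arrive at `some c'`.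
      · have hn : ∀ m, (flip bind M.tm.step)^[m] none = none := by
          intro m
          induction m with
          | zero => rfl
          | succ m ih => rw [Function.iterate_succ_apply]; exact ih
        have : flip bind M.tm.step (some c) = none := hs
        rw [this, hn] at hm
        simp at hm
      · have e₁ : flip bind M.tm.step (some c) = some c₁ := hs
        have e₂ : flip bind (TM2.step (composedCode M p)) (some (liftCfg p c)) =
            some (liftCfg p c₁) := step_liftCfg M p hs
        rw [e₁] at hm
        rw [e₂]
        exact ih hm

/-- The composed machine. -/
noncomputable def composed : TM2ComputableAux α Bool where
  tm :=
    letI := M.tm.kFin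
    letI := M.tm.ΛFin
    letI := M.tm.σFin
    letI : Fintype p.Lab := Fintype.ofFinite _
    { K := M.tm.K ⊕ Stk
      k₀ := Sum.inl M.tm.k₀
      k₁ := Sum.inr .temp
      Γ := composedSymbol M.tm.Γ
      Λ := ComposedLabel M.tm.Λ p
      main := Sum.inl M.tm.main
      σ := M.tm.σ × Option Bool
      initialState := (M.tm.initialState, none)
      Γk₀Fin := M.tm.Γk₀Fin
      m := composedCode M p }
  inputAlphabet := M.inputAlphabet
  outputAlphabet := Equiv.refl Bool

/-- The state with a given input, in which the other stacks are empty. -/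
def inputState (l : List ℕ) : Stk → List ℕ
  | .input => l
  | _ => []

/-- The state with a given output, in which the other stacks are empty. -/
def outputState (l : List ℕ) : Stk → List ℕ
  | .temp => l
  | _ => []

theorem initList_stk_self (tm : FinTM2) (x : List (tm.Γ tm.k₀)) :
    (initList tm x).stk tm.k₀ = x := by
  simp [initList]

theorem initList_stk_of_ne (tm : FinTM2) (x : List (tm.Γ tm.k₀)) {k : tm.K} (h : k ≠ tm.k₀) :
    (initList tm x).stk k = [] := by
  simp [initList, h]

theorem haltList_stk_self (tm : FinTM2) (x : List (tm.Γ tm.k₁)) :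
    (haltList tm x).stk tm.k₁ = x := by
  simp [haltList]

theorem haltList_stk_of_ne (tm : FinTM2) (x : List (tm.Γ tm.k₁)) {k : tm.K} (h : k ≠ tm.k₁) :
    (haltList tm x).stk k = [] := by
  simp [haltList, h]

theorem liftCfg_initList (x : List α) :
    liftCfg p (initList M.tm (x.map M.inputAlphabet.symm)) =
      initList (composed M p).tm (x.map (composed M p).inputAlphabet.symm) := by
  have h : liftStk (initList M.tm (x.map M.inputAlphabet.symm)).stk =
      (initList (composed M p).tm (x.map (composed M p).inputAlphabet.symm)).stk := by
    funext k
    rcases k with k | k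
    · by_cases h : k = M.tm.k₀
      · subst h
        exact (initList_stk_self M.tm _).trans (initList_stk_self (composed M p).tm _).symm
      · have h' : (Sum.inl k : M.tm.K ⊕ Stk) ≠ Sum.inl M.tm.k₀ := by simpa using h
        exact (initList_stk_of_ne M.tm _ h).trans (initList_stk_of_ne (composed M p).tm _ h').symm
    · have h' : (Sum.inr k : M.tm.K ⊕ Stk) ≠ Sum.inl M.tm.k₀ := by simp
      exact (initList_stk_of_ne (composed M p).tm _ h').symm
  exact congrArg (fun S => (⟨some (Sum.inl M.tm.main), (M.tm.initialState, none), S⟩ :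
    TM2.Cfg (composedSymbol M.tm.Γ) (ComposedLabel M.tm.Λ p) (M.tm.σ × Option Bool))) h

/-- When `M` halts, only its output stack can be nonempty, and the program reads that stack as
`input`. The additional step resets the register, since the required final configuration carries the
initial state. -/
theorem composed_outputs {x : List α} {l l' : List ℕ} {t₁ t₂ : ℕ}
    (hM : Nonempty (TM2OutputsInTime M.tm (x.map M.inputAlphabet.symm)
      (some ((encodeNats l).map M.outputAlphabet.symm)) t₁))
    (hp : p.Exec (inputState l) t₂ (outputState l')) :
    Nonempty (TM2OutputsInTime (composed M p).tm (x.map (composed M p).inputAlphabet.symm)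
      (some ((encodeNats l').map (composed M p).outputAlphabet.symm)) (t₁ + t₂ + 1)) := by
  have r₁ := reachesIn_liftCfg M p (show ReachesIn M.tm.step _ _ t₁ from hM)
  set S₁ := liftStk (haltList M.tm ((encodeNats l).map M.outputAlphabet.symm)).stk with hS₁
  have hS : (composedLayout M).Holds S₁ (inputState l) S₁ := by
    refine ⟨?_, fun _ _ => rfl⟩
    rintro (_ | _)
    · exact haltList_stk_self M.tm _
    all_goals rfl
  obtain ⟨y, S₂, hS₂, r₂⟩ := StackProg.exec_code (composedLayout M) S₁ (composedCode M p) hp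
    (fun l => Sum.inr (Sum.inl l)) (Sum.inr (Sum.inr ())) (fun _ => rfl)
    (M.tm.initialState, none) S₁ hS
  have r₃ : ReachesIn (TM2.step (composedCode M p))
      ⟨some (Sum.inr (Sum.inr ())), (M.tm.initialState, y), S₂⟩
      ⟨none, (M.tm.initialState, none), S₂⟩ 1 := .single rfl
  have r := (r₁.trans r₂).trans r₃
  have h : S₂ =
      (haltList (composed M p).tm ((encodeNats l').map (composed M p).outputAlphabet.symm)).stk := by
    funext k
    by_cases hk : k = Sum.inr .temp
    · subst hk
      exact (hS₂.stack .temp).trans (haltList_stk_self (composed M p).tm _).symm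
    · refine Eq.trans ?_ (haltList_stk_of_ne (composed M p).tm _ hk).symm
      rcases k with k | k
      · by_cases h : k = M.tm.k₁
        · subst h
          exact hS₂.stack .input
        · exact (hS₂.other (Sum.inl k) (by rintro (_ | _) <;> simp [composedLayout, Ne.symm h])).trans
            (haltList_stk_of_ne M.tm _ h)
      · cases k with
        | temp => exact absurd rfl hk
        | input => exact hS₂.other (Sum.inr .input) (by rintro (_ | _) <;> simp [composedLayout])
        | env => exact hS₂.stack .env
        | opnd => exact hS₂.stack .opnd
        | ctr => exact hS₂.stack .ctr
        | out => exact hS₂.stack .out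
  rw [liftCfg_initList, h] at r
  exact r

/-! ### The output length -/

/-- The number of pushes in a statement, which bounds the growth of the stacks in a step. -/
def pushes {K : Type} {Γ : K → Type} {Λ σ : Type} : TM2.Stmt Γ Λ σ → ℕ
  | .push _ _ q => pushes q + 1
  | .peek _ _ q => pushes q
  | .pop _ _ q => pushes q
  | .load _ q => pushes q
  | .branch _ q₁ q₂ => pushes q₁ + pushes q₂
  | .goto _ => 0
  | .halt => 0

theorem length_stepAux_le {K : Type} [DecidableEq K] {Γ : K → Type} {Λ σ : Type} (k : K)
    (q : TM2.Stmt Γ Λ σ) (v : σ) (S : ∀ k, List (Γ k)) :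
    ((TM2.stepAux q v S).stk k).length ≤ (S k).length + pushes q := by
  induction q generalizing v S with
  | push k' f q ih =>
      rw [TM2.stepAux, pushes]
      refine (ih _ _).trans ?_
      by_cases h : k = k'
      · subst h; simp; omega
      · rw [Function.update_of_ne h]; omega
  | peek k' f q ih => exact ih _ _
  | pop k' f q ih =>
      rw [TM2.stepAux, pushes]
      refine (ih _ _).trans ?_
      by_cases h : k = k'
      · subst h; simp
      · rw [Function.update_of_ne h]
  | load f q ih => exact ih _ _
  | branch f q₁ q₂ ih₁ ih₂ =>
      rw [TM2.stepAux, pushes]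
      have h₁ := ih₁ v S
      have h₂ := ih₂ v S
      cases f v
      · exact h₂.trans (by omega)
      · exact h₁.trans (by omega)
  | goto f => exact le_rfl
  | halt => exact le_rfl

/-- A step lengthens a stack by at most the number of pushes in one statement; the sum over all
labels bounds this uniformly. This controls the size of the intermediate instance when reductions
are composed. -/
theorem exists_output_length_le {α β : Type} (M : TM2ComputableAux α β) : ∃ C : ℕ,
    ∀ (x : List (M.tm.Γ M.tm.k₀)) (y : List (M.tm.Γ M.tm.k₁)) (t : ℕ),
      Nonempty (TM2OutputsInTime M.tm x (some y) t) → y.length ≤ x.length + C * t := by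
  let _ := M.tm.ΛFin
  refine ⟨∑ l, pushes (M.tm.m l), fun x y t h => ?_⟩
  obtain ⟨⟨⟨m, hm⟩, hmt⟩⟩ := h
  have key : ∀ (m : ℕ) (c c' : M.tm.Cfg), (flip bind M.tm.step)^[m] (some c) = some c' →
      (c'.stk M.tm.k₁).length ≤ (c.stk M.tm.k₁).length + (∑ l, pushes (M.tm.m l)) * m := by
    intro m
    induction m with
    | zero =>
        intro c c' h
        simp only [Function.iterate_zero, id_eq, Option.some.injEq] at h
        simp [h]
    | succ m ih =>
        intro c c' h
        rw [Function.iterate_succ_apply'] at h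
        rcases hc : (flip bind M.tm.step)^[m] (some c) with _ | c₁
        · rw [hc] at h
          cases h
        · rw [hc] at h
          have h' : M.tm.step c₁ = some c' := h
          have h₁ := ih _ _ hc
          obtain ⟨l, v, S⟩ := c₁
          cases l with
          | none => cases h'
          | some l =>
              have h' : TM2.stepAux (M.tm.m l) v S = c' := Option.some.inj h'
              have h₂ := length_stepAux_le M.tm.k₁ (M.tm.m l) v S
              rw [h'] at h₂
              have h₃ : pushes (M.tm.m l) ≤ ∑ l, pushes (M.tm.m l) :=
                Finset.single_le_sum (f := fun l => pushes (M.tm.m l)) (fun _ _ => Nat.zero_le _)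
                  (Finset.mem_univ l)
              rw [mul_add_one]
              simp only at h₁
              omega
  have h := key m _ _ hm
  have hy : ((haltList M.tm y).stk M.tm.k₁).length = y.length := by rw [haltList_stk_self]
  have hx : ((initList M.tm x).stk M.tm.k₁).length ≤ x.length := by
    by_cases e : M.tm.k₁ = M.tm.k₀
    -- The type of a stack depends on its index, so the equation is substituted for a variable.
    · have : ∀ k, k = M.tm.k₀ → ((initList M.tm x).stk k).length ≤ x.length := by
        rintro k rfl
        rw [initList_stk_self]
      exact this _ e
    · rw [initList_stk_of_ne M.tm x e]
      exact Nat.zero_le _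
  rw [hy] at h
  exact h.trans (Nat.add_le_add hx (Nat.mul_le_mul_left _ hmt))

end Turing

/-! ### Programs for arithmetic expressions -/

namespace StackProg

theorem Exec.cast {K : Type} [DecidableEq K] {p : StackProg K} {s s' s'' : K → List ℕ} {t t' : ℕ}
    (h : Exec p s t s') (hs : s' = s'') (ht : t ≤ t') : Exec p s t' s'' :=
  hs ▸ h.mono ht

section Macros

variable {K : Type} [DecidableEq K]

/-- The target starts at an arbitrary `m`, both for the induction and because the same loop performs
addition. -/
theorem exec_transfer {X Y : K} (hXY : X ≠ Y) (n : ℕ) : ∀ (s : K → List ℕ) (m : ℕ) (l l' : List ℕ),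
    s X = n :: l → s Y = m :: l' → Exec (loop X (inc Y)) s (2 * n + 1)
      (Function.update (Function.update s X l) Y ((m + n) :: l')) := by
  induction n with
  | zero =>
      intro s m l l' h h'
      refine (Exec.loop_zero X (inc Y) s l h).cast ?_ (by omega)
      funext k
      simp only [Function.update_apply]
      split_ifs <;> simp_all
  | succ n ih =>
      intro s m l l' h h'
      refine (Exec.loop_succ h (.inc Y _ m l' ?_) (ih _ (m + 1) l l' ?_ ?_)).cast ?_ (by omega)
      · rw [Function.update_of_ne hXY.symm, h']
      · rw [Function.update_of_ne hXY, Function.update_self]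
      · rw [Function.update_self]
      · funext k
        simp only [Function.update_apply]
        split_ifs <;> simp_all <;> omega

/-- Move the top number from the stack `X` to the stack `Y`. -/
def move (X Y : K) : StackProg K := .seq (.zero Y) (.loop X (.inc Y))

theorem exec_move {X Y : K} (hXY : X ≠ Y) {s : K → List ℕ} {n : ℕ} {l : List ℕ}
    (h : s X = n :: l) : Exec (move X Y) s (2 * n + 2)
      (Function.update (Function.update s X l) Y (n :: s Y)) := by
  refine (Exec.seq (.zero Y s) (exec_transfer hXY n _ 0 l (s Y) ?_ ?_)).cast ?_ (by omega)
  · rw [Function.update_of_ne hXY, h]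
  · rw [Function.update_self]
  · funext k
    simp only [Function.update_apply]
    split_ifs <;> simp_all

/-- Remove the top number. -/
def drop (X : K) : StackProg K := .loop X .skip

theorem exec_drop {X : K} (n : ℕ) : ∀ {s : K → List ℕ} {l : List ℕ}, s X = n :: l →
    Exec (drop X) s (2 * n + 1) (Function.update s X l) := by
  induction n with
  | zero => intro s l h; exact (Exec.loop_zero X _ s l h).mono (by omega)
  | succ n ih =>
      intro s l h
      refine (Exec.loop_succ h (.skip _) (ih (l := l) ?_)).cast ?_ (by omega)
      · rw [Function.update_self]
      · rw [Function.update_idem]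

/-- Move all numbers from the stack `Y` to the stack `X`. -/
def moveAll (Y X : K) : StackProg K := .whileNE Y (move Y X)

theorem exec_moveAll {X Y : K} (hXY : Y ≠ X) (j : List ℕ) : ∀ {s : K → List ℕ}, s Y = j →
    Exec (moveAll Y X) s (2 * j.sum + 3 * j.length + 1)
      (Function.update (Function.update s Y []) X (j.reverse ++ s X)) := by
  induction j with
  | nil =>
      intro s h
      refine (Exec.while_nil Y _ s h).cast ?_ (by simp)
      funext k
      simp only [Function.update_apply]
      split_ifs <;> simp_all
  | cons n j ih =>
      intro s h
      refine (Exec.while_cons (by simp [h]) (exec_move hXY h) (ih ?_)).cast ?_ ?_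
      · rw [Function.update_of_ne hXY, Function.update_self]
      · funext k
        simp only [Function.update_apply]
        split_ifs <;> simp_all
      · simp only [List.sum_cons, List.length_cons]; omega

/-- Remove all numbers from the stack `X`. -/
def clear (X : K) : StackProg K := .whileNE X (drop X)

theorem exec_clear {X : K} (j : List ℕ) : ∀ {s : K → List ℕ}, s X = j →
    Exec (clear X) s (2 * j.sum + 2 * j.length + 1) (Function.update s X []) := by
  induction j with
  | nil =>
      intro s h
      refine (Exec.while_nil X _ s h).cast ?_ (by simp)
      rw [← h, Function.update_eq_self]
  | cons n j ih =>
      intro s h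
      refine (Exec.while_cons (by simp [h]) (exec_drop n h) (ih ?_)).cast ?_ ?_
      · rw [Function.update_self]
      · rw [Function.update_idem]
      · simp only [List.sum_cons, List.length_cons]; omega

variable (X T S : K)

/-- Put a copy of the top number of the stack `X` on the stack `S`, with the help of `T`. -/
def copy : StackProg K :=
  .seq (.zero T) (.seq (.loop X (.inc T)) (.seq (.zero X) (.seq (.zero S)
    (.loop T (.seq (.inc X) (.inc S))))))

variable {X T S}

theorem exec_copy (hXT : X ≠ T) (hXS : X ≠ S) (hTS : T ≠ S) {s : K → List ℕ} {n : ℕ} {l : List ℕ}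
    (h : s X = n :: l) :
    Exec (copy X T S) s (5 * n + 5) (Function.update s S (n :: s S)) := by
  have key : ∀ (m : ℕ) (s : K → List ℕ) (a b : ℕ) (l l' l'' : List ℕ), s T = m :: l'' →
      s X = a :: l → s S = b :: l' →
      Exec (loop T (.seq (.inc X) (.inc S))) s (3 * m + 1) (Function.update (Function.update
        (Function.update s T l'') X ((a + m) :: l)) S ((b + m) :: l')) := by
    intro m
    induction m with
    | zero =>
        intro s a b l l' l'' hT hX hS
        refine (Exec.loop_zero T _ s l'' hT).cast ?_ (by omega)
        funext k
        simp only [Function.update_apply]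
        split_ifs <;> simp_all
    | succ m ih =>
        intro s a b l l' l'' hT hX hS
        refine (Exec.loop_succ hT (.seq (.inc X _ a l ?_) (.inc S _ b l' ?_))
          (ih _ (a + 1) (b + 1) l l' l'' ?_ ?_ ?_)).cast ?_ (by omega)
        · rw [Function.update_of_ne hXT, hX]
        · rw [Function.update_of_ne hXS.symm, Function.update_of_ne hTS.symm, hS]
        · rw [Function.update_of_ne hTS, Function.update_of_ne hXT.symm, Function.update_self]
        · rw [Function.update_of_ne hXS, Function.update_self]
        · rw [Function.update_self]
        · funext k
          simp only [Function.update_apply]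
          split_ifs <;> simp_all <;> omega
  refine (Exec.seq (.zero T s) (.seq (exec_transfer hXT n _ 0 l (s T) ?_ ?_)
    (.seq (.zero X _) (.seq (.zero S _) (key n _ 0 0 l (s S) (s T) ?_ ?_ ?_))))).cast ?_ (by omega)
  · rw [Function.update_of_ne hXT, h]
  · rw [Function.update_self]
  · rw [Function.update_of_ne hTS, Function.update_of_ne hXT.symm, Function.update_self, zero_add]
  · rw [Function.update_of_ne hXS, Function.update_self, Function.update_of_ne hXT,
      Function.update_self]
  · rw [Function.update_self, Function.update_of_ne hXS.symm, Function.update_of_ne hTS.symm,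
      Function.update_of_ne hXS.symm, Function.update_of_ne hTS.symm]
  · funext k
    simp only [Function.update_apply]
    split_ifs <;> simp_all

variable (X T S)

/-- Replace the top number `i` of the stack `S` by entry `i` of the stack `X`. -/
def fetch : StackProg K :=
  .seq (.loop S (.ifNE X (move X T) .skip)) (.seq (.ifNE X (copy X T S) (.zero S)) (moveAll T X))

variable {X T S}

/-- A round costs `4` besides the unary moving cost, and the moved numbers add up to at most the sum
of `X`. Beyond the end of `X` the rounds do nothing. -/
theorem exec_advance (hXT : X ≠ T) (hXS : X ≠ S) (hTS : T ≠ S) (i : ℕ) :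
    ∀ {s : K → List ℕ} {l : List ℕ}, s S = i :: l →
    Exec (.loop S (.ifNE X (move X T) .skip)) s (4 * i + 2 * (s X).sum + 1)
      (Function.update (Function.update (Function.update s S l) X ((s X).drop i)) T
        (((s X).take i).reverse ++ s T)) := by
  induction i with
  | zero =>
      intro s l h
      refine (Exec.loop_zero S _ s l h).cast ?_ (by omega)
      funext k
      simp only [Function.update_apply]
      split_ifs <;> simp_all
  | succ i ih =>
      intro s l h
      rcases hX : s X with _ | ⟨n, x⟩
      · refine (Exec.loop_succ h (.if_nil ?_ (.skip _)) (ih (l := l) ?_)).cast ?_ ?_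
        · rw [Function.update_of_ne hXS, hX]
        · rw [Function.update_self]
        · funext k
          simp only [Function.update_apply]
          split_ifs <;> simp_all
        · rw [Function.update_of_ne hXS, hX]; simp; omega
      · refine (Exec.loop_succ h (.if_cons ?_ (exec_move hXT (n := n) (l := x) ?_))
          (ih (l := l) ?_)).cast ?_ ?_
        · rw [Function.update_of_ne hXS, hX]; simp
        · rw [Function.update_of_ne hXS, hX]
        · rw [Function.update_of_ne hTS.symm, Function.update_of_ne hXS.symm, Function.update_self]
        · funext k
          simp only [Function.update_apply]
          split_ifs <;> simp_all
        · rw [Function.update_of_ne hXT, Function.update_self, List.sum_cons]; omega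

/-- The length of the string for a list of numbers. -/
def _root_.List.unarySize (l : List ℕ) : ℕ := l.sum + l.length

/-- The first `i` entries are unwound onto `T`, the next one is copied, and `T` is poured back. All
of `T` ends up on `X`, so it must be empty at the start. -/
theorem exec_fetch (hXT : X ≠ T) (hXS : X ≠ S) (hTS : T ≠ S) {s : K → List ℕ} {i : ℕ} {l : List ℕ}
    (h : s S = i :: l) (hT : s T = []) :
    Exec (fetch X T S) s (4 * i + 9 * (s X).unarySize + 8)
      (Function.update s S ((s X).getD i 0 :: l)) := by
  have e₁ := exec_advance hXT hXS hTS i h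
  set s₁ := Function.update (Function.update (Function.update s S l) X ((s X).drop i)) T
    (((s X).take i).reverse ++ s T) with hs₁
  have hX₁ : s₁ X = (s X).drop i := by
    rw [hs₁, Function.update_of_ne hXT, Function.update_self]
  have hT₁ : s₁ T = ((s X).take i).reverse := by rw [hs₁, Function.update_self, hT, List.append_nil]
  have hS₁ : s₁ S = l := by
    rw [hs₁, Function.update_of_ne hTS.symm, Function.update_of_ne hXS.symm, Function.update_self]
  have hle : (s X).getD i 0 ≤ (s X).sum := by
    by_cases hi : i < (s X).length
    · rw [List.getD_eq_getElem _ _ hi]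
      exact List.single_le_sum (by simp) _ (List.getElem_mem hi)
    · rw [List.getD_eq_default _ _ (by omega)]; omega
  have e₂ : Exec (.ifNE X (copy X T S) (.zero S)) s₁ (5 * (s X).sum + 6)
      (Function.update s₁ S ((s X).getD i 0 :: l)) := by
    by_cases hi : i < (s X).length
    · have hx : s₁ X = (s X).getD i 0 :: (s X).drop (i + 1) := by
        rw [hX₁, List.getD_eq_getElem _ _ hi, List.drop_eq_getElem_cons hi]
      refine (Exec.if_cons (by simp [hx]) (exec_copy hXT hXS hTS hx)).cast ?_ (by omega)
      rw [hS₁]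
    · refine (Exec.if_nil ?_ (.zero S s₁)).cast ?_ (by omega)
      · rw [hX₁, List.drop_eq_nil_of_le (by omega)]
      · rw [hS₁, List.getD_eq_default _ _ (by omega)]
  have e₃ := exec_moveAll (Y := T) (X := X) hXT.symm ((s X).take i).reverse
    (s := Function.update s₁ S ((s X).getD i 0 :: l))
    (by rw [Function.update_of_ne hTS, hT₁])
  refine (e₁.seq (e₂.seq e₃)).cast ?_ ?_
  · funext k
    simp only [Function.update_apply]
    split_ifs <;> simp_all
  · have h₁ : ((s X).take i).reverse.sum ≤ (s X).sum := by
      rw [List.sum_reverse]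
      exact (List.take_sublist i _).sum_le_sum (by simp)
    have h₂ : ((s X).take i).reverse.length ≤ (s X).length := by simp
    rw [List.unarySize]
    omega

end Macros

end StackProg

/-! ### Polynomially bounded functions -/

/-- A monotone function that is bounded by a polynomial. -/
structure PolyGrowth (f : ℕ → ℕ) : Prop where
  mono : Monotone f
  bound : ∃ C c : ℕ, ∀ n, f n ≤ C * (n + 1) ^ c

namespace PolyGrowth

variable {f g : ℕ → ℕ}

theorem const (a : ℕ) : PolyGrowth fun _ => a :=
  ⟨fun _ _ _ => le_rfl, a, 0, fun _ => by simp⟩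

theorem id : PolyGrowth fun n => n := ⟨fun _ _ h => h, 1, 1, fun _ => by simp⟩

theorem add (hf : PolyGrowth f) (hg : PolyGrowth g) : PolyGrowth fun n => f n + g n := by
  obtain ⟨C, c, h⟩ := hf.bound
  obtain ⟨C', c', h'⟩ := hg.bound
  refine ⟨hf.mono.add hg.mono, C + C', max c c', fun n => ?_⟩
  have e : (n + 1) ^ c ≤ (n + 1) ^ max c c' := Nat.pow_le_pow_right (by omega) (le_max_left ..)
  have e' : (n + 1) ^ c' ≤ (n + 1) ^ max c c' := Nat.pow_le_pow_right (by omega) (le_max_right ..)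
  rw [add_mul]
  exact add_le_add ((h n).trans (Nat.mul_le_mul_left _ e)) ((h' n).trans (Nat.mul_le_mul_left _ e'))

theorem mul (hf : PolyGrowth f) (hg : PolyGrowth g) : PolyGrowth fun n => f n * g n := by
  obtain ⟨C, c, h⟩ := hf.bound
  obtain ⟨C', c', h'⟩ := hg.bound
  refine ⟨fun a b hab => Nat.mul_le_mul (hf.mono hab) (hg.mono hab), C * C', c + c', fun n => ?_⟩
  rw [pow_add, mul_mul_mul_comm]
  exact Nat.mul_le_mul (h n) (h' n)

theorem comp (hf : PolyGrowth f) (hg : PolyGrowth g) : PolyGrowth fun n => f (g n) := by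
  obtain ⟨C, c, h⟩ := hf.bound
  obtain ⟨C', c', h'⟩ := hg.bound
  refine ⟨hf.mono.comp hg.mono, C * (C' + 1) ^ c, c' * c, fun n => (h _).trans ?_⟩
  rw [mul_assoc, pow_mul, ← mul_pow]
  refine Nat.mul_le_mul_left _ (Nat.pow_le_pow_left ?_ _)
  have : 0 < (n + 1) ^ c' := by positivity
  have := h' n
  rw [add_mul]
  omega

theorem const_mul (a : ℕ) (hf : PolyGrowth f) : PolyGrowth fun n => a * f n := (const a).mul hf

end PolyGrowth

/-! ### Arithmetic expressions -/

/-- Expressions for natural numbers, with an input list and variables (de Bruijn indices). -/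
inductive Expr
  | const : ℕ → Expr
  | var : ℕ → Expr
  /-- the entry of the input list at some position -/
  | look : Expr → Expr
  | add : Expr → Expr → Expr
  | sub : Expr → Expr → Expr
  /-- `sum n f` is the sum of `f` for all values less than `n` of a new variable -/
  | sum : Expr → Expr → Expr
  /-- `bind₂ a b f` evaluates `f` with two new variables for `b` (index `0`) and `a` (index `1`) -/
  | bind₂ : Expr → Expr → Expr → Expr
  /-- `iter n c a f` iterates `f` for `n` times from `a`, where the values are cut down to `c` -/
  | iter : Expr → Expr → Expr → Expr → Expr

namespace Expr

/-- The value of an expression. -/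
def eval (inp : List ℕ) : Expr → List ℕ → ℕ
  | const n, _ => n
  | var i, env => env.getD i 0
  | look e, env => inp.getD (eval inp e env) 0
  | add a b, env => eval inp a env + eval inp b env
  | sub a b, env => eval inp a env - eval inp b env
  | sum n f, env => ∑ i ∈ Finset.range (eval inp n env), eval inp f (i :: env)
  | bind₂ a b f, env => eval inp f (eval inp b env :: eval inp a env :: env)
  | iter n c a f, env =>
      -- With truncated subtraction, `f - (f - c)` is the minimum of `f` and `c`. The cap keeps
      -- iterated values polynomial.
      (fun x => eval inp f (x :: eval inp c env :: env) -
        (eval inp f (x :: eval inp c env :: env) - eval inp c env))^[eval inp n env]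
          (eval inp a env)

/-- A bound for the value of an expression and for the time that is needed to compute it. -/
def bound : Expr → ℕ → ℕ
  | const n, _ => n + 1
  | var i, B => 5 * i + 9 * B + 9
  | look e, B => 5 * bound e B + 9 * B + 8
  | add a b, B => bound a B + 5 * bound b B + 3
  | sub a b, B => bound a B + 5 * bound b B + 3
  | sum n f, B => 5 * bound n B + 6 + bound n B * (5 * bound f (B + bound n B + 1) + 6)
  | bind₂ a b f, B => 5 * bound a B + 7 * bound b B + 8 + bound f (B + bound a B + bound b B + 2)
  | iter n c a f, B =>
      3 * bound n B + 5 * bound a B + 8 * bound c B + 20 +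
        bound n B * (6 * bound f (B + bound a B + 2 * bound c B + 2) +
          9 * (B + bound a B + 2 * bound c B + 2) + 8 * bound c B + 2 * bound a B + 30)

/-- Binders evaluate their body at a polynomially enlarged `B`. As the expression is fixed, there
are boundedly many nested compositions. -/
theorem polyGrowth_bound (e : Expr) : PolyGrowth e.bound := by
  induction e with
  | const n => exact .const _
  | var i => exact ((PolyGrowth.const _).add (.const_mul _ .id)).add (.const _)
  | look e ih => exact ((ih.const_mul _).add (.const_mul _ .id)).add (.const _)
  | add a b iha ihb => exact (iha.add (ihb.const_mul _)).add (.const _)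
  | sub a b iha ihb => exact (iha.add (ihb.const_mul _)).add (.const _)
  | sum n f ihn ihf =>
      exact ((ihn.const_mul _).add (.const _)).add
        (ihn.mul (((ihf.comp ((PolyGrowth.id.add ihn).add (.const _))).const_mul _).add (.const _)))
  | bind₂ a b f iha ihb ihf =>
      exact (((iha.const_mul _).add (ihb.const_mul _)).add (.const _)).add
        (ihf.comp (((PolyGrowth.id.add iha).add ihb).add (.const _)))
  | iter n c a f ihn ihc iha ihf =>
      have h := ((PolyGrowth.id.add iha).add (ihc.const_mul 2)).add (.const 2)
      exact ((((ihn.const_mul _).add (iha.const_mul _)).add (ihc.const_mul _)).add (.const _)).add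
        (ihn.mul (((((ihf.comp h).const_mul _).add (h.const_mul _)).add (ihc.const_mul _)).add
          (iha.const_mul _) |>.add (.const _)))

open StackProg

/-- Put a number on the operand stack. -/
def putConst : ℕ → StackProg Stk
  | 0 => .zero .opnd
  | n + 1 => .seq (putConst n) (.inc .opnd)

/-- Add the top two numbers of the operand stack. -/
def addTop : StackProg Stk :=
  .seq (move .opnd .temp) (.loop .temp (.inc .opnd))

/-- Subtract the top number of the operand stack from the next one. -/
def subTop : StackProg Stk :=
  .seq (move .opnd .temp) (.loop .temp (.dec .opnd))

/-- A program that puts the value of the expression on the operand stack. -/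
def compile : Expr → StackProg Stk
  | const n => putConst n
  | var i => .seq (putConst i) (fetch .env .temp .opnd)
  | look e => .seq (compile e) (fetch .input .temp .opnd)
  | add a b => .seq (compile a) (.seq (compile b) addTop)
  | sub a b => .seq (compile a) (.seq (compile b) subTop)
  | sum n f => .seq (compile n) (.seq (move .opnd .ctr) (.seq (.zero .opnd) (.seq (.zero .env)
      (.seq (.loop .ctr (.seq (compile f) (.seq addTop (.inc .env)))) (drop .env)))))
  -- The value of `b` waits on `ctr`, so that it ends up above that of `a` in the environment.
  | bind₂ a b f => .seq (compile a) (.seq (compile b) (.seq (move .opnd .ctr)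
      (.seq (move .opnd .env) (.seq (move .ctr .env)
        (.seq (compile f) (.seq (drop .env) (drop .env)))))))
  | iter n c a f => .seq (compile n) (.seq (move .opnd .ctr) (.seq (compile a) (.seq (compile c)
      (.seq (move .opnd .env) (.seq (move .opnd .env) (.seq
        -- The capped value `f - (f - c)` needs `f` twice; `c` is entry `1` of the environment,
        -- below the current iterate.
        (.loop .ctr (.seq (compile f) (.seq (compile f) (.seq (putConst 1)
          (.seq (fetch .env .temp .opnd) (.seq subTop (.seq subTop
            (.seq (drop .env) (move .opnd .env)))))))))
        (.seq (move .env .opnd) (drop .env))))))))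

end Expr

/-! ### Correctness and running time of compiled expressions -/

/-- The state with the given stacks. -/
def stkState (i d s j r o : List ℕ) : Stk → List ℕ
  | .input => i
  | .env => d
  | .opnd => s
  | .temp => j
  | .ctr => r
  | .out => o

section stkState

variable (i d s j r o x : List ℕ)

@[simp] theorem stkState_input : stkState i d s j r o .input = i := rfl
@[simp] theorem stkState_env : stkState i d s j r o .env = d := rfl
@[simp] theorem stkState_opnd : stkState i d s j r o .opnd = s := rfl
@[simp] theorem stkState_temp : stkState i d s j r o .temp = j := rfl
@[simp] theorem stkState_ctr : stkState i d s j r o .ctr = r := rfl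
@[simp] theorem stkState_out : stkState i d s j r o .out = o := rfl

@[simp] theorem update_stkState_input :
    Function.update (stkState i d s j r o) .input x = stkState x d s j r o := by
  funext k; cases k <;> rfl
@[simp] theorem update_stkState_env :
    Function.update (stkState i d s j r o) .env x = stkState i x s j r o := by
  funext k; cases k <;> rfl
@[simp] theorem update_stkState_opnd :
    Function.update (stkState i d s j r o) .opnd x = stkState i d x j r o := by
  funext k; cases k <;> rfl
@[simp] theorem update_stkState_temp :
    Function.update (stkState i d s j r o) .temp x = stkState i d s x r o := by
  funext k; cases k <;> rfl
@[simp] theorem update_stkState_ctr :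
    Function.update (stkState i d s j r o) .ctr x = stkState i d s j x o := by
  funext k; cases k <;> rfl
@[simp] theorem update_stkState_out :
    Function.update (stkState i d s j r o) .out x = stkState i d s j r x := by
  funext k; cases k <;> rfl

end stkState

namespace Expr

open StackProg

variable {inp d s j r o : List ℕ}

theorem exec_zero_opnd : Exec (.zero .opnd) (stkState inp d s j r o) 1
    (stkState inp d (0 :: s) j r o) := by
  simpa using Exec.zero Stk.opnd (stkState inp d s j r o)

theorem exec_zero_env : Exec (.zero .env) (stkState inp d s j r o) 1
    (stkState inp (0 :: d) s j r o) := by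
  simpa using Exec.zero Stk.env (stkState inp d s j r o)

theorem exec_inc_opnd (n : ℕ) : Exec (.inc .opnd) (stkState inp d (n :: s) j r o) 1
    (stkState inp d ((n + 1) :: s) j r o) := by
  simpa using Exec.inc Stk.opnd (stkState inp d (n :: s) j r o) n s rfl

theorem exec_inc_env (n : ℕ) : Exec (.inc .env) (stkState inp (n :: d) s j r o) 1
    (stkState inp ((n + 1) :: d) s j r o) := by
  simpa using Exec.inc Stk.env (stkState inp (n :: d) s j r o) n d rfl

theorem exec_dec_opnd (n : ℕ) : Exec (.dec .opnd) (stkState inp d (n :: s) j r o) 1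
    (stkState inp d ((n - 1) :: s) j r o) := by
  simpa using Exec.dec Stk.opnd (stkState inp d (n :: s) j r o) n s rfl

theorem exec_loop_ctr_zero (p : StackProg Stk) : Exec (.loop .ctr p)
    (stkState inp d s j (0 :: r) o) 1 (stkState inp d s j r o) := by
  simpa using Exec.loop_zero Stk.ctr p (stkState inp d s j (0 :: r) o) r rfl

theorem exec_loop_ctr_succ {p : StackProg Stk} {n t₁ t₂ : ℕ} {s₁ s₂ : Stk → List ℕ}
    (h₁ : Exec p (stkState inp d s j (n :: r) o) t₁ s₁) (h₂ : Exec (.loop .ctr p) s₁ t₂ s₂) :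
    Exec (.loop .ctr p) (stkState inp d s j ((n + 1) :: r) o) (1 + t₁ + t₂) s₂ :=
  Exec.loop_succ (l := r) rfl (by simpa using h₁) h₂

theorem exec_putConst (n : ℕ) : Exec (putConst n) (stkState inp d s j r o) (n + 1)
    (stkState inp d (n :: s) j r o) := by
  induction n with
  | zero => exact exec_zero_opnd
  | succ n ih => exact ih.seq (exec_inc_opnd n)

theorem exec_opnd_temp (n : ℕ) : Exec (move .opnd .temp) (stkState inp d (n :: s) j r o) (2 * n + 2)
    (stkState inp d s (n :: j) r o) := by
  simpa using exec_move (X := Stk.opnd) (Y := .temp) (by decide)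
    (s := stkState inp d (n :: s) j r o) rfl

theorem exec_addTop (a b : ℕ) : Exec addTop (stkState inp d (b :: a :: s) j r o) (4 * b + 3)
    (stkState inp d ((a + b) :: s) j r o) := by
  refine Exec.cast ((exec_opnd_temp b).seq (t₂ := 2 * b + 1) ?_) rfl (by omega)
  simpa using exec_transfer (X := Stk.temp) (Y := .opnd) (by decide) b
    (stkState inp d (a :: s) (b :: j) r o) a j s rfl rfl

theorem exec_subTop (a b : ℕ) : Exec subTop (stkState inp d (b :: a :: s) j r o) (4 * b + 3)
    (stkState inp d ((a - b) :: s) j r o) := by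
  have key : ∀ b a, Exec (.loop .temp (.dec .opnd)) (stkState inp d (a :: s) (b :: j) r o)
      (2 * b + 1) (stkState inp d ((a - b) :: s) j r o) := by
    intro b
    induction b with
    | zero =>
        intro a
        simpa using Exec.loop_zero Stk.temp (.dec .opnd) (stkState inp d (a :: s) (0 :: j) r o) j rfl
    | succ b ih =>
        intro a
        have h := ih (a - 1)
        rw [Nat.sub_sub, add_comm 1 b] at h
        have h' := Exec.loop_succ (s := stkState inp d (a :: s) ((b + 1) :: j) r o)
          (k := Stk.temp) (l := j) rfl (by rw [update_stkState_temp]; exact exec_dec_opnd a) h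
        exact h'.mono (by omega)
  exact Exec.cast ((exec_opnd_temp b).seq (key b a)) rfl (by omega)

theorem exec_fetch_env (i : ℕ) : Exec (fetch .env .temp .opnd) (stkState inp d (i :: s) [] r o)
    (4 * i + 9 * d.unarySize + 8) (stkState inp d (d.getD i 0 :: s) [] r o) := by
  simpa using exec_fetch (X := Stk.env) (T := .temp) (S := .opnd) (by decide) (by decide)
    (by decide) (s := stkState inp d (i :: s) [] r o) rfl rfl

theorem exec_fetch_input (i : ℕ) : Exec (fetch .input .temp .opnd) (stkState inp d (i :: s) [] r o)
    (4 * i + 9 * inp.unarySize + 8) (stkState inp d (inp.getD i 0 :: s) [] r o) := by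
  simpa using exec_fetch (X := Stk.input) (T := .temp) (S := .opnd) (by decide) (by decide)
    (by decide) (s := stkState inp d (i :: s) [] r o) rfl rfl

theorem exec_opnd_ctr (n : ℕ) : Exec (move .opnd .ctr) (stkState inp d (n :: s) j r o) (2 * n + 2)
    (stkState inp d s j (n :: r) o) := by
  simpa using exec_move (X := Stk.opnd) (Y := .ctr) (by decide)
    (s := stkState inp d (n :: s) j r o) rfl

theorem exec_opnd_env (n : ℕ) : Exec (move .opnd .env) (stkState inp d (n :: s) j r o) (2 * n + 2)
    (stkState inp (n :: d) s j r o) := by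
  simpa using exec_move (X := Stk.opnd) (Y := .env) (by decide)
    (s := stkState inp d (n :: s) j r o) rfl

theorem exec_opnd_out (n : ℕ) : Exec (move .opnd .out) (stkState inp d (n :: s) j r o) (2 * n + 2)
    (stkState inp d s j r (n :: o)) := by
  simpa using exec_move (X := Stk.opnd) (Y := .out) (by decide)
    (s := stkState inp d (n :: s) j r o) rfl

theorem exec_ctr_env (n : ℕ) : Exec (move .ctr .env) (stkState inp d s j (n :: r) o) (2 * n + 2)
    (stkState inp (n :: d) s j r o) := by
  simpa using exec_move (X := Stk.ctr) (Y := .env) (by decide)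
    (s := stkState inp d s j (n :: r) o) rfl

theorem exec_env_opnd (n : ℕ) : Exec (move .env .opnd) (stkState inp (n :: d) s j r o) (2 * n + 2)
    (stkState inp d (n :: s) j r o) := by
  simpa using exec_move (X := Stk.env) (Y := .opnd) (by decide)
    (s := stkState inp (n :: d) s j r o) rfl

theorem exec_drop_env (n : ℕ) : Exec (drop .env) (stkState inp (n :: d) s j r o) (2 * n + 1)
    (stkState inp d s j r o) := by
  simpa using exec_drop n (s := stkState inp (n :: d) s j r o) (X := Stk.env) rfl

theorem getD_le_unarySize (l : List ℕ) (i : ℕ) : l.getD i 0 ≤ l.unarySize := by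
  rw [List.unarySize]
  by_cases hi : i < l.length
  · rw [List.getD_eq_getElem _ _ hi]
    exact (List.single_le_sum (by simp) _ (List.getElem_mem hi)).trans (by omega)
  · rw [List.getD_eq_default _ _ (by omega)]; omega

theorem unarySize_cons (n : ℕ) (l : List ℕ) : (n :: l).unarySize = n + 1 + l.unarySize := by
  simp [List.unarySize]; omega

/-- The program of an expression computes its value within the bound. -/
theorem exec_compile (e : Expr) : ∀ (d s r : List ℕ) (B : ℕ), inp.unarySize + d.unarySize ≤ B →
    e.eval inp d ≤ e.bound B ∧ Exec e.compile (stkState inp d s [] r o) (e.bound B)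
      (stkState inp d (e.eval inp d :: s) [] r o) := by
  induction e with
  | const n => intro d s r B hB; exact ⟨by simp [eval, bound], exec_putConst n⟩
  | var i =>
      intro d s r B hB
      have h := getD_le_unarySize d i
      refine ⟨by simp only [eval, bound]; omega, ((exec_putConst i).seq (exec_fetch_env i)).mono ?_⟩
      simp only [bound]; omega
  | look e ih =>
      intro d s r B hB
      obtain ⟨h₁, h₂⟩ := ih d s r B hB
      have h := getD_le_unarySize inp (e.eval inp d)
      refine ⟨by simp only [eval, bound]; omega, (h₂.seq (exec_fetch_input _)).mono ?_⟩
      simp only [bound]; omega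
  | add a b iha ihb =>
      intro d s r B hB
      obtain ⟨h₁, h₂⟩ := iha d s r B hB
      obtain ⟨h₃, h₄⟩ := ihb d (a.eval inp d :: s) r B hB
      refine ⟨by simp only [eval, bound]; omega, (h₂.seq (h₄.seq (exec_addTop _ _))).mono ?_⟩
      simp only [bound]; omega
  | sub a b iha ihb =>
      intro d s r B hB
      obtain ⟨h₁, h₂⟩ := iha d s r B hB
      obtain ⟨h₃, h₄⟩ := ihb d (a.eval inp d :: s) r B hB
      refine ⟨by simp only [eval, bound]; omega, (h₂.seq (h₄.seq (exec_subTop _ _))).mono ?_⟩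
      simp only [bound]; omega
  | sum n f ihn ihf =>
      intro d s r B hB
      obtain ⟨h₁, h₂⟩ := ihn d s r B hB
      set N := n.eval inp d with hN
      -- The new variable is below `N ≤ n.bound B`, which bounds the size of the extended
      -- environment.
      have hF : ∀ i < N, ∀ s r, f.eval inp (i :: d) ≤ f.bound (B + n.bound B + 1) ∧
          Exec f.compile (stkState inp (i :: d) s [] r o) (f.bound (B + n.bound B + 1))
            (stkState inp (i :: d) (f.eval inp (i :: d) :: s) [] r o) := fun i hi s r =>
        ihf (i :: d) s r _ (by rw [unarySize_cons]; omega)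
      set F := f.bound (B + n.bound B + 1) with hFdef
      -- Invariant: `i` is the current value of the variable, `a` the partial sum, `m` the number of
      -- remaining rounds.
      have key : ∀ (m i a : ℕ), i + m ≤ N →
          Exec (.loop .ctr (.seq f.compile (.seq addTop (.inc .env))))
            (stkState inp (i :: d) (a :: s) [] (m :: r) o) (m * (5 * F + 6) + 1)
            (stkState inp ((i + m) :: d)
              ((a + ∑ x ∈ Finset.range m, f.eval inp ((i + x) :: d)) :: s) [] r o) := by
        intro m
        induction m with
        | zero =>
            intro i a _
            exact Exec.cast (exec_loop_ctr_zero _) (by simp) (by omega)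
        | succ m ih =>
            intro i a him
            obtain ⟨h₃, h₄⟩ := hF i (by omega) (a :: s) (m :: r)
            refine Exec.cast (exec_loop_ctr_succ (h₄.seq ((exec_addTop _ _).seq (exec_inc_env i)))
              (ih (i + 1) _ (by omega))) ?_ ?_
            · rw [Finset.sum_range_succ', add_zero, add_assoc a,
                add_comm (f.eval inp (i :: d)), add_right_comm i 1 m]
              simp only [add_assoc, add_comm, add_left_comm]
            · rw [Nat.add_one_mul m]; omega
      have hmul : N * (5 * F + 6) ≤ n.bound B * (5 * F + 6) := Nat.mul_le_mul_right _ h₁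
      have hval : (sum n f).eval inp d ≤ N * F := by
        rw [eval, ← hN]
        refine (Finset.sum_le_card_nsmul _ _ F fun i hi => ?_).trans (by simp)
        exact (hF i (by simpa using hi) [] []).1
      refine ⟨hval.trans ?_, ?_⟩
      · have : N * F ≤ n.bound B * (5 * F + 6) := Nat.mul_le_mul h₁ (by omega)
        simp only [bound, ← hFdef]; omega
      · refine (h₂.seq ((exec_opnd_ctr _).seq (exec_zero_opnd.seq (exec_zero_env.seq
          ((key N 0 0 (by omega)).seq (exec_drop_env _)))))).cast ?_ ?_
        · simp [eval, ← hN]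
        · simp only [bound, ← hFdef]; omega
  | bind₂ a b f iha ihb ihf =>
      intro d s r B hB
      obtain ⟨h₁, h₂⟩ := iha d s r B hB
      obtain ⟨h₃, h₄⟩ := ihb d (a.eval inp d :: s) r B hB
      obtain ⟨h₅, h₆⟩ := ihf (b.eval inp d :: a.eval inp d :: d) s r
        (B + a.bound B + b.bound B + 2) (by rw [unarySize_cons, unarySize_cons]; omega)
      refine ⟨by simp only [eval, bound]; omega, (h₂.seq (h₄.seq ((exec_opnd_ctr _).seq
        ((exec_opnd_env _).seq ((exec_ctr_env _).seq (h₆.seq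
          ((exec_drop_env _).seq (exec_drop_env _)))))))).mono ?_⟩
      simp only [bound]; omega
  | iter n c a f ihn ihc iha ihf =>
      intro d s r B hB
      obtain ⟨h₁, h₂⟩ := ihn d s r B hB
      set N := n.eval inp d with hN
      obtain ⟨h₃, h₄⟩ := iha d s (N :: r) B hB
      obtain ⟨h₅, h₆⟩ := ihc d (a.eval inp d :: s) (N :: r) B hB
      set A := a.eval inp d with hA
      set C := c.eval inp d with hC
      set G := B + a.bound B + 2 * c.bound B + 2 with hG
      set F := f.bound G with hFdef
      set φ : ℕ → ℕ := fun x => f.eval inp (x :: C :: d) - (f.eval inp (x :: C :: d) - C) with hφ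
      have hφC : ∀ x, φ x ≤ C := fun x => by simp only [hφ]; omega
      -- The iterate is `A` at first and at most `C` afterwards, so the one size bound `G` serves
      -- all rounds.
      have key : ∀ (m x : ℕ), x ≤ A + C →
          Exec (.loop .ctr (.seq f.compile (.seq f.compile (.seq (putConst 1)
          (.seq (fetch .env .temp .opnd) (.seq subTop (.seq subTop
            (.seq (drop .env) (move .opnd .env)))))))))
            (stkState inp (x :: C :: d) s [] (m :: r) o)
            (m * (6 * F + 9 * G + 8 * c.bound B + 2 * a.bound B + 30) + 1)
            (stkState inp (φ^[m] x :: C :: d) s [] r o) := by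
        intro m
        induction m with
        | zero =>
            intro x _
            exact Exec.cast (exec_loop_ctr_zero _) (by simp) (by omega)
        | succ m ih =>
            intro x hx
            have hsz : inp.unarySize + (x :: C :: d).unarySize ≤ G := by
              rw [unarySize_cons, unarySize_cons]; omega
            obtain ⟨h₇, h₈⟩ := ihf (x :: C :: d) s (m :: r) G hsz
            obtain ⟨-, h₉⟩ := ihf (x :: C :: d) (f.eval inp (x :: C :: d) :: s) (m :: r) G hsz
            have hφx := hφC x
            refine Exec.cast (exec_loop_ctr_succ (h₈.seq (h₉.seq ((exec_putConst 1).seq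
              ((exec_fetch_env 1).seq ((exec_subTop _ _).seq ((exec_subTop _ _).seq
                ((exec_drop_env _).seq (exec_opnd_env _)))))))) (ih (φ x) (by omega))) ?_ ?_
            · rfl
            · rw [Nat.add_one_mul m]
              have hφx' : f.eval inp (x :: C :: d) - (f.eval inp (x :: C :: d) - C) ≤ C := hφx
              simp only [List.getD_cons_succ, List.getD_cons_zero]
              omega
      have hval : ∀ m, φ^[m] A ≤ A + C := by
        intro m
        cases m with
        | zero => simp
        | succ m => rw [Function.iterate_succ_apply']; exact (hφC _).trans (by omega)
      have hmul := Nat.mul_le_mul_right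
        (6 * F + 9 * G + 8 * c.bound B + 2 * a.bound B + 30) h₁
      have hv := hval N
      have hev : (iter n c a f).eval inp d = φ^[N] A := rfl
      refine ⟨?_, ?_⟩
      · rw [hev]
        simp only [bound]; omega
      · rw [hev]
        refine (h₂.seq ((exec_opnd_ctr _).seq (h₄.seq (h₆.seq ((exec_opnd_env _).seq
          ((exec_opnd_env _).seq ((key N A (by omega)).seq ((exec_env_opnd _).seq
            (exec_drop_env _))))))))).mono ?_
        simp only [bound, ← hG, ← hFdef]; omega

end Expr

/-! ### Programs for lists of numbers -/

/-- Programs that write a list of natural numbers. -/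
inductive ListProg
  | emit : Expr → ListProg
  | seq : ListProg → ListProg → ListProg
  /-- repeat the body for all values less than a bound of a new variable -/
  | forRange : Expr → ListProg → ListProg

namespace ListProg

open StackProg Expr

/-- The list that a program writes. -/
def eval (inp : List ℕ) : ListProg → List ℕ → List ℕ
  | emit e, env => [e.eval inp env]
  | seq p q, env => eval inp p env ++ eval inp q env
  | forRange n p, env => (List.range (n.eval inp env)).flatMap fun i => eval inp p (i :: env)

/-- A bound for the length of the output and for the running time. -/
def bound : ListProg → ℕ → ℕ
  | emit e, B => 3 * e.bound B + 2
  | seq p q, B => bound p B + bound q B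
  | forRange n p, B => 5 * n.bound B + 5 + n.bound B * (bound p (B + n.bound B + 1) + 2)

theorem polyGrowth_bound (p : ListProg) : PolyGrowth p.bound := by
  induction p with
  | emit e => exact (e.polyGrowth_bound.const_mul _).add (.const _)
  | seq p q ihp ihq => exact ihp.add ihq
  | forRange n p ih =>
      have hn := n.polyGrowth_bound
      exact ((hn.const_mul _).add (.const _)).add
        (hn.mul ((ih.comp ((PolyGrowth.id.add hn).add (.const _))).add (.const _)))

/-- A program that writes the list, in reverse order, on the output stack. -/
def compile : ListProg → StackProg Stk
  | emit e => .seq e.compile (move .opnd .out)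
  | seq p q => .seq (compile p) (compile q)
  | forRange n p => .seq n.compile (.seq (move .opnd .ctr) (.seq (.zero .env)
      (.seq (.loop .ctr (.seq (compile p) (.inc .env))) (drop .env))))

theorem unarySize_append (l l' : List ℕ) :
    (l ++ l').unarySize = l.unarySize + l'.unarySize := by
  simp [List.unarySize]; omega

variable {inp : List ℕ}

theorem exec_compile (p : ListProg) : ∀ (d s r o : List ℕ) (B : ℕ),
    inp.unarySize + d.unarySize ≤ B → (p.eval inp d).unarySize ≤ p.bound B ∧
      Exec p.compile (stkState inp d s [] r o) (p.bound B)
        (stkState inp d s [] r ((p.eval inp d).reverse ++ o)) := by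
  induction p with
  | emit e =>
      intro d s r o B hB
      obtain ⟨h₁, h₂⟩ := e.exec_compile (o := o) d s r B hB
      refine ⟨?_, Exec.cast (h₂.seq (exec_opnd_out _)) (by simp [eval]) ?_⟩
      · simp [eval, bound, List.unarySize]; omega
      · simp only [bound]; omega
  | seq p q ihp ihq =>
      intro d s r o B hB
      obtain ⟨h₁, h₂⟩ := ihp d s r o B hB
      obtain ⟨h₃, h₄⟩ := ihq d s r ((p.eval inp d).reverse ++ o) B hB
      refine ⟨?_, Exec.cast (h₂.seq h₄) (by simp [eval]) le_rfl⟩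
      rw [eval, unarySize_append]
      exact add_le_add h₁ h₃
  | forRange n p ih =>
      intro d s r o B hB
      obtain ⟨h₁, h₂⟩ := n.exec_compile (o := o) d s r B hB
      set N := n.eval inp d with hN
      have hF : ∀ i < N, ∀ r o, (p.eval inp (i :: d)).unarySize ≤ p.bound (B + n.bound B + 1) ∧
          Exec p.compile (stkState inp (i :: d) s [] r o) (p.bound (B + n.bound B + 1))
            (stkState inp (i :: d) s [] r ((p.eval inp (i :: d)).reverse ++ o)) := fun i hi r o =>
        ih (i :: d) s r o _ (by rw [unarySize_cons]; omega)
      set F := p.bound (B + n.bound B + 1) with hFdef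
      have key : ∀ (m i : ℕ) (o : List ℕ), i + m ≤ N →
          ((List.range m).flatMap fun x => p.eval inp ((i + x) :: d)).unarySize ≤ m * (F + 2) ∧
          Exec (.loop .ctr (.seq p.compile (.inc .env)))
            (stkState inp (i :: d) s [] (m :: r) o) (m * (F + 2) + 1)
            (stkState inp ((i + m) :: d) s [] r
              (((List.range m).flatMap fun x => p.eval inp ((i + x) :: d)).reverse ++ o)) := by
        intro m
        induction m with
        | zero =>
            intro i o _
            exact ⟨by simp [List.unarySize], Exec.cast (exec_loop_ctr_zero _) (by simp) (by omega)⟩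
        | succ m ihm =>
            intro i o him
            obtain ⟨h₃, h₄⟩ := hF i (by omega) (m :: r) o
            obtain ⟨h₅, h₆⟩ := ihm (i + 1) ((p.eval inp (i :: d)).reverse ++ o) (by omega)
            have e : ((List.range (m + 1)).flatMap fun x => p.eval inp ((i + x) :: d)) =
                p.eval inp (i :: d) ++
                  (List.range m).flatMap fun x => p.eval inp ((i + 1 + x) :: d) := by
              rw [List.range_succ_eq_map, List.flatMap_cons, List.flatMap_map, add_zero]
              simp only [Nat.succ_eq_add_one, add_assoc, add_comm 1]
            refine ⟨?_, Exec.cast (exec_loop_ctr_succ (h₄.seq (exec_inc_env i)) h₆) ?_ ?_⟩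
            · rw [e, unarySize_append, Nat.add_one_mul m]; omega
            · rw [e, List.reverse_append, List.append_assoc, add_right_comm, add_assoc i m 1]
            · rw [Nat.add_one_mul m]; omega
      have hmul : N * (F + 2) ≤ n.bound B * (F + 2) := Nat.mul_le_mul_right _ h₁
      obtain ⟨h₃, h₄⟩ := key N 0 o (by omega)
      simp only [zero_add] at h₃ h₄
      refine ⟨?_, ?_⟩
      · rw [eval, ← hN]
        simp only [bound, ← hFdef]
        omega
      · refine Exec.cast (h₂.seq ((exec_opnd_ctr _).seq (exec_zero_env.seq
          (h₄.seq (exec_drop_env _))))) ?_ ?_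
        · rw [eval, ← hN]
        · simp only [bound, ← hFdef]; omega

/-- The complete program, which leaves its output on an otherwise empty collection of stacks. -/
def program (p : ListProg) : StackProg Stk :=
  .seq p.compile (.seq (clear .input) (moveAll .out .temp))

/-- A bound for the running time. -/
def time (p : ListProg) (B : ℕ) : ℕ := 4 * p.bound B + 2 * B + 2

theorem polyGrowth_time (p : ListProg) : PolyGrowth p.time :=
  ((p.polyGrowth_bound.const_mul _).add (.const_mul _ .id)).add (.const _)

/-- Moving the output to `temp` undoes its reversal. The input is cleared because only the output
stack may be nonempty in the end. -/
theorem exec_program (p : ListProg) :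
    Exec p.program (Turing.inputState inp) (p.time inp.unarySize)
      (Turing.outputState (p.eval inp [])) := by
  have e : Turing.inputState inp = stkState inp [] [] [] [] [] := by funext k; cases k <;> rfl
  have e' : Turing.outputState (p.eval inp []) = stkState [] [] [] (p.eval inp []) [] [] := by
    funext k; cases k <;> rfl
  rw [e, e']
  obtain ⟨h₁, h₂⟩ := p.exec_compile (inp := inp) [] [] [] [] inp.unarySize (by simp [List.unarySize])
  have h₃ := exec_clear (X := Stk.input) inp
    (s := stkState inp [] [] [] [] ((p.eval inp []).reverse ++ [])) rfl
  have h₄ := exec_moveAll (Y := Stk.out) (X := .temp) (by decide) ((p.eval inp []).reverse ++ [])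
    (s := stkState [] [] [] [] [] ((p.eval inp []).reverse ++ [])) rfl
  rw [update_stkState_input] at h₃
  refine Exec.cast (h₂.seq (h₃.seq h₄)) (by simp) ?_
  simp only [List.append_nil, List.sum_reverse, List.length_reverse, time]
  simp only [List.unarySize] at h₁ ⊢
  omega

end ListProg

/-! ### Reductions by programs -/

theorem length_encodeNats (l : List ℕ) : (encodeNats l).length = l.unarySize := by
  induction l with
  | nil => rfl
  | cons n l ih => rw [encodeNats_cons, Expr.unarySize_cons]; simp [ih]; omega

namespace Computable

theorem nat_add {f g : ℕ → ℕ} (hf : Computable f) (hg : Computable g) :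
    Computable fun n => f n + g n := Primrec.nat_add.to_comp.comp hf hg

theorem nat_mul {f g : ℕ → ℕ} (hf : Computable f) (hg : Computable g) :
    Computable fun n => f n * g n := Primrec.nat_mul.to_comp.comp hf hg

theorem nat_pow_const {f : ℕ → ℕ} (hf : Computable f) (c : ℕ) : Computable fun n => f n ^ c := by
  induction c with
  | zero => exact Computable.const 1
  | succ c ih => simpa only [pow_succ] using ih.nat_mul hf

end Computable

/-- If a program computes a reduction from `Q` to `R` and bounds the parameter of the result, then
an fpt-reduction from `P` to `Q` gives an fpt-reduction from `P` to `R`. -/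
theorem FPTReducible.trans_listProg {P Q R : ParamProblem} (hQ : Q.Sym = Bool) (hR : R.Sym = Bool)
    (codeQ : Q.Inst → List ℕ) (codeR : R.Inst → List ℕ)
    (hcodeQ : ∀ x, (Q.enc x).map (Equiv.cast hQ) = encodeNats (codeQ x))
    (hcodeR : ∀ x, (R.enc x).map (Equiv.cast hR) = encodeNats (codeR x))
    (red : Q.Inst → R.Inst) (p : ListProg) (hp : ∀ x, p.eval (codeQ x) [] = codeR (red x))
    (hred : ∀ x, Q.Yes x ↔ R.Yes (red x)) (g' : ℕ → ℕ) (hg'c : Computable g') (hg'm : Monotone g')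
    (hg' : ∀ x, R.param (red x) ≤ g' (Q.param x)) (h : FPTReducible P Q) : FPTReducible P R := by
  obtain ⟨IQ, SQ, fQ, encQ, injQ, parQ, yesQ⟩ := Q
  obtain ⟨IR, SR, fR, encR, injR, parR, yesR⟩ := R
  dsimp only at hQ hR
  subst hQ hR
  simp only [Equiv.cast_refl, Equiv.coe_refl, List.map_id_fun, id_eq] at hcodeQ hcodeR
  obtain ⟨f, M, g, H, c, hg, hH, hf, hpar, htime⟩ := h
  dsimp only at *
  obtain ⟨C, hC⟩ := Turing.exists_output_length_le M
  obtain ⟨C', c', hC'⟩ := p.polyGrowth_time.bound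
  refine ⟨fun x => red (f x), Turing.composed M p.program, fun k => g' (g k),
    -- The three summands pay for `M`, for the program on the output of `M`, and for the final
    -- halting step.
    fun k => H k + C' * (1 + C * H k) ^ c' + 1, c + (c + 1) * c', hg'c.comp hg, ?_,
    fun x => (hf x).trans (hred _), fun x => (hg' _).trans (hg'm (hpar x)), fun x => ?_⟩
  · exact (hH.nat_add ((Computable.const _).nat_mul
      (((Computable.const _).nat_add ((Computable.const _).nat_mul hH)).nat_pow_const _))).nat_add
      (Computable.const _)
  · dsimp only
    have h₁ := htime x
    rw [hcodeQ] at h₁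
    have h₂ := Turing.composed_outputs M p.program h₁ p.exec_program
    rw [hp, ← hcodeR] at h₂
    have h₃ := hC _ _ _ h₁
    simp only [List.length_map, length_encodeNats] at h₃
    refine ReachesIn.mono h₂ ?_
    set k := P.param x
    set N := (P.enc x).length
    have hN : 1 ≤ N + 1 := by omega
    have e₁ : (N + 1) ^ c ≤ (N + 1) ^ (c + (c + 1) * c') := Nat.pow_le_pow_right hN (by omega)
    have e₂ : ((N + 1) ^ (c + 1)) ^ c' ≤ (N + 1) ^ (c + (c + 1) * c') := by
      rw [← pow_mul]; exact Nat.pow_le_pow_right hN (by omega)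
    -- The exponent is `c + 1` so that the input length itself is absorbed even if `c = 0`.
    have e₃ : (codeQ (f x)).unarySize + 1 ≤ (1 + C * H k) * (N + 1) ^ (c + 1) := by
      have a₁ : N + 1 ≤ (N + 1) ^ (c + 1) := Nat.le_self_pow (by omega) _
      have a₂ : C * (H k * (N + 1) ^ c) ≤ C * H k * (N + 1) ^ (c + 1) := by
        rw [mul_assoc]
        exact Nat.mul_le_mul_left _ (Nat.mul_le_mul_left _ (Nat.pow_le_pow_right hN (by omega)))
      rw [add_mul, one_mul]
      omega
    have e₄ : p.time (codeQ (f x)).unarySize ≤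
        C' * (1 + C * H k) ^ c' * (N + 1) ^ (c + (c + 1) * c') := by
      refine (hC' _).trans ?_
      rw [mul_assoc]
      refine Nat.mul_le_mul_left _ ((Nat.pow_le_pow_left e₃ _).trans ?_)
      rw [mul_pow]
      exact Nat.mul_le_mul_left _ e₂
    have e₅ : 1 ≤ (N + 1) ^ (c + (c + 1) * c') := Nat.one_le_pow _ _ (by omega)
    have e₆ := Nat.mul_le_mul_left (H k) e₁
    rw [add_mul, add_mul, one_mul]
    omega

/-! ### Bundles of paths -/

/-- There are `2 * ℓ` paths of length `len` from `s` to `t`. The vertices of a path whose positions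
are multiples of `seg π` are shared with the path `rep π`. -/
structure PathSystem where
  ℓ : ℕ
  len : ℕ
  seg : ℕ → ℕ
  rep : ℕ → ℕ
  len_pos : 0 < len
  seg_pos : ∀ π, 0 < seg π
  rep_lt : ∀ π, π < 2 * ℓ → rep π < 2 * ℓ
  rep_rep : ∀ π, π < 2 * ℓ → rep (rep π) = rep π
  seg_rep : ∀ π, π < 2 * ℓ → seg (rep π) = seg π

namespace PathSystem

variable (P : PathSystem)

/-- The vertex at position `p` of the path `π`. -/
def vertex (π p : ℕ) : ℕ :=
  -- The numbers `0` and `1` are reserved for source and sink. A shared vertex has the number that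
  -- belongs to the representative path; unused numbers become isolated vertices.
  if p = 0 then 0 else if p = P.len then 1 else
    if p % P.seg π = 0 then 2 + (P.rep π * P.len + p) else 2 + (π * P.len + p)

theorem mul_add_lt {n l π p : ℕ} (hπ : π < n) (hp : p < l) : π * l + p < n * l :=
  calc π * l + p < π * l + l := by omega
    _ = (π + 1) * l := by ring
    _ ≤ n * l := Nat.mul_le_mul_right _ hπ

theorem mul_add_div {l p : ℕ} (π : ℕ) (hp : p < l) : (π * l + p) / l = π := by
  rw [mul_comm, Nat.mul_add_div (by omega), Nat.div_eq_of_lt hp, add_zero]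

theorem mul_add_mod {l p : ℕ} (π : ℕ) (hp : p < l) : (π * l + p) % l = p := by
  rw [mul_comm, Nat.mul_add_mod, Nat.mod_eq_of_lt hp]

theorem vertex_lt {π p : ℕ} (hπ : π < 2 * P.ℓ) (hp : p ≤ P.len) :
    P.vertex π p < 2 + 2 * P.ℓ * P.len := by
  unfold vertex
  split_ifs with h₁ h₂ h₃
  · omega
  · omega
  · have := mul_add_lt (P.rep_lt π hπ) (show p < P.len by omega)
    omega
  · have := mul_add_lt hπ (show p < P.len by omega)
    omega

/-- The position of a vertex. -/
def rank (u : ℕ) : ℕ := if u = 0 then 0 else if u = 1 then P.len else (u - 2) % P.len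

/-- A shared vertex has the same position on all its paths, so the position depends on the vertex
only. It grows by one along every arc, which excludes cycles. -/
theorem rank_vertex {π p : ℕ} (hp : p ≤ P.len) : P.rank (P.vertex π p) = p := by
  unfold vertex rank
  split_ifs <;> first
    | omega
    | contradiction
    | (rw [Nat.add_sub_cancel_left]; exact mul_add_mod _ (by omega))

/-- The number of arcs. -/
abbrev numArcs : ℕ := 2 * P.ℓ * P.len

theorem div_lt (a : Fin P.numArcs) : (a : ℕ) / P.len < 2 * P.ℓ :=
  Nat.div_lt_of_lt_mul (by rw [mul_comm]; exact a.2)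

theorem mod_lt (a : ℕ) : a % P.len < P.len := Nat.mod_lt _ P.len_pos

/-- The multigraph that consists of the paths. -/
def graph : DirMultigraph (Fin (2 + 2 * P.ℓ * P.len)) (Fin P.numArcs) where
  src a := ⟨P.vertex (a / P.len) (a % P.len), P.vertex_lt (P.div_lt a) (P.mod_lt a).le⟩
  tgt a := ⟨P.vertex (a / P.len) (a % P.len + 1), P.vertex_lt (P.div_lt a) (P.mod_lt a)⟩

theorem rank_of_isWalk (l : List (Fin P.numArcs)) : ∀ u v, P.graph.IsWalk l u v →
    P.rank v = P.rank u + l.length := by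
  induction l with
  | nil => rintro u v rfl; rfl
  | cons a l ih =>
      rintro u v ⟨rfl, h⟩
      rw [ih _ _ h]
      simp only [graph, List.length_cons]
      rw [P.rank_vertex (P.mod_lt a), P.rank_vertex (P.mod_lt a).le]
      omega

theorem isAcyclic : P.graph.IsAcyclic := by
  intro v p hp
  have := P.rank_of_isWalk p v v hp
  exact List.length_eq_zero_iff.1 (by omega)

/-- The arc at position `p` of the path `π`. -/
def arc (π p : ℕ) (hπ : π < 2 * P.ℓ) (hp : p < P.len) : Fin P.numArcs :=
  ⟨π * P.len + p, mul_add_lt hπ hp⟩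

/-- The source. -/
def source : Fin (2 + 2 * P.ℓ * P.len) := ⟨0, by omega⟩

/-- The sink. -/
def sink : Fin (2 + 2 * P.ℓ * P.len) := ⟨1, by omega⟩

theorem isWalk_ofFn {π : ℕ} (hπ : π < 2 * P.ℓ) (m : ℕ) :
    ∀ (p : ℕ) (f : Fin m → Fin P.numArcs), (∀ j, (f j : ℕ) = π * P.len + (p + j)) →
    ∀ (hp : p + m ≤ P.len), P.graph.IsWalk (List.ofFn f) ⟨P.vertex π p, P.vertex_lt hπ (by omega)⟩
      ⟨P.vertex π (p + m), P.vertex_lt hπ hp⟩ := by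
  induction m with
  | zero => intro p f _ hp; rw [List.ofFn_zero]; exact rfl
  | succ m ih =>
      intro p f hf hp
      rw [List.ofFn_succ]
      have h₀ : (f 0 : ℕ) = π * P.len + p := by simpa using hf 0
      have hd : (f 0 : ℕ) / P.len = π := by rw [h₀, mul_add_div _ (by omega)]
      have hm : (f 0 : ℕ) % P.len = p := by rw [h₀, mul_add_mod _ (by omega)]
      refine ⟨by simp only [graph, hd, hm], ?_⟩
      have := ih (p + 1) (fun j => f j.succ)
        (fun j => by rw [hf, Fin.val_succ, add_assoc p 1, add_comm 1]) (by omega)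
      have e : p + (m + 1) = p + 1 + m := by omega
      simp only [graph, hd, hm, e]
      exact this

theorem exists_isWalk {π p q : ℕ} (hπ : π < 2 * P.ℓ) (hpq : p ≤ q) (hq : q ≤ P.len) :
    ∃ l, P.graph.IsWalk l ⟨P.vertex π p, P.vertex_lt hπ (by omega)⟩
        ⟨P.vertex π q, P.vertex_lt hπ hq⟩ ∧
      ∀ a ∈ l, (a : ℕ) / P.len = π ∧ p ≤ (a : ℕ) % P.len ∧ (a : ℕ) % P.len < q := by
  obtain ⟨m, rfl⟩ := Nat.exists_eq_add_of_le hpq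
  refine ⟨_, P.isWalk_ofFn hπ m p (fun j => P.arc π (p + j) hπ (by omega)) (fun _ => rfl) hq, ?_⟩
  intro a ha
  obtain ⟨j, rfl⟩ := (List.mem_ofFn' _ _).1 ha
  have hj : p + j < P.len := by omega
  simp only [arc]
  rw [mul_add_div _ hj, mul_add_mod _ hj]
  exact ⟨rfl, by omega, by omega⟩

theorem isWalk_append {l l' : List (Fin P.numArcs)} : ∀ {u v w}, P.graph.IsWalk l u v →
    P.graph.IsWalk l' v w → P.graph.IsWalk (l ++ l') u w := by
  induction l with
  | nil => rintro u v w rfl h'; exact h'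
  | cons a l ih => rintro u v w ⟨h₁, h₂⟩ h'; exact ⟨h₁, ih h₂ h'⟩

/-- The arcs of a path. -/
def path (π : Fin (2 * P.ℓ)) : List (Fin P.numArcs) :=
  List.ofFn fun j : Fin P.len => P.arc π j π.2 j.2

theorem mem_path (π : Fin (2 * P.ℓ)) (a : Fin P.numArcs) : a ∈ P.path π ↔ (a : ℕ) / P.len = π := by
  rw [path, List.mem_ofFn']
  constructor
  · rintro ⟨j, rfl⟩
    exact mul_add_div _ j.2
  · intro h
    refine ⟨⟨a % P.len, P.mod_lt a⟩, Fin.ext ?_⟩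
    simp only [arc, ← h]
    rw [mul_comm]
    exact Nat.div_add_mod _ _

/-- The instance of the paired minimum cut problem for a pairing of the arcs. -/
def toInstance (mate : Fin P.numArcs → Fin P.numArcs) (hmate : ∀ a, mate (mate a) = a)
    (hne : ∀ a, mate a ≠ a) : PairedCutInstance where
  numVerts := 2 + 2 * P.ℓ * P.len
  numArcs := P.numArcs
  graph := P.graph
  acyclic := P.isAcyclic
  s := P.source
  t := P.sink
  s_ne_t := by simp [source, sink]
  ℓ := P.ℓ
  mate := mate
  mate_mate := hmate
  mate_ne := hne
  path := P.path
  path_isWalk π := by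
    have h := P.isWalk_ofFn π.2 P.len 0 (fun j => P.arc π j π.2 j.2)
      (fun j => by simp [arc]) (by omega)
    have hs : (⟨P.vertex π 0, P.vertex_lt π.2 (by omega)⟩ : Fin (2 + 2 * P.ℓ * P.len)) = P.source := by
      simp [vertex, source]
    have ht : (⟨P.vertex π (0 + P.len), P.vertex_lt π.2 (by omega)⟩ :
        Fin (2 + 2 * P.ℓ * P.len)) = P.sink := by
      simp [vertex, sink, P.len_pos.ne']
    rwa [hs, ht] at h
  path_partition a := ⟨⟨a / P.len, P.div_lt a⟩, (P.mem_path _ a).2 rfl, fun π h =>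
    Fin.ext ((P.mem_path _ a).1 h).symm⟩

/-- Cutting every path at one position, in the same segment on paths that share vertices,
gives a cut. -/
theorem isCut_of_consistent (c : ℕ → ℕ) (hc : ∀ π < 2 * P.ℓ, c π < P.len)
    (hrep : ∀ π < 2 * P.ℓ, c π / P.seg π = c (P.rep π) / P.seg π) (B : Finset (Fin P.numArcs))
    (hB : ∀ a : Fin P.numArcs, (a : ℕ) % P.len = c (a / P.len) → a ∈ B) :
    P.graph.IsCut P.source P.sink B := by
  -- The source side of the cut: it contains the source but not the sink, and only arcs of `B` leave
  -- it.
  let Before (u : ℕ) : Prop := u = 0 ∨ 2 ≤ u ∧ (u - 2) % P.len ≤ c ((u - 2) / P.len)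
  have key : ∀ π p, π < 2 * P.ℓ → p ≤ P.len → (Before (P.vertex π p) ↔ p ≤ c π) := by
    intro π p hπ hp
    have hcπ := hc π hπ
    simp only [Before, vertex]
    split_ifs with h₁ h₂ h₃
    · simp [h₁]
    · simp [h₂, hcπ]
    · have hp' : p < P.len := by omega
      rw [Nat.add_sub_cancel_left, mul_add_div _ hp', mul_add_mod _ hp']
      -- At a multiple of the segment length, comparing positions means comparing segments, so the
      -- representative gives the same answer as `π`.
      have hle : ∀ x, p ≤ x ↔ p / P.seg π ≤ x / P.seg π := fun x => by
        rw [Nat.le_div_iff_mul_le (P.seg_pos π), Nat.div_mul_cancel (Nat.dvd_of_mod_eq_zero h₃)]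
      rw [hle (c (P.rep π)), hle (c π), hrep π hπ]
      omega
    · have hp' : p < P.len := by omega
      rw [Nat.add_sub_cancel_left, mul_add_div _ hp', mul_add_mod _ hp']
      omega
  have walk : ∀ (l : List (Fin P.numArcs)) (u v : Fin (2 + 2 * P.ℓ * P.len)),
      P.graph.IsWalk l u v → Before u → (∀ a ∈ l, a ∉ B) → Before v := by
    intro l
    induction l with
    | nil => rintro u v rfl hu _; exact hu
    | cons a l ih =>
        rintro u v ⟨rfl, h⟩ hu hl
        refine ih _ v h ?_ fun b hb => hl b (List.mem_cons_of_mem _ hb)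
        have h₁ := (key _ _ (P.div_lt a) (P.mod_lt a).le).1 hu
        have h₂ : (a : ℕ) % P.len ≠ c (a / P.len) := fun e => hl a (by simp) (hB a e)
        exact (key _ _ (P.div_lt a) (P.mod_lt a)).2 (by omega)
  intro l hl
  by_contra! h
  have := walk l _ _ hl (Or.inl rfl) h
  simp [Before, sink] at this

/-- If a cut contains exactly one arc of every path, then paths that share vertices are cut in the
same segment. -/
theorem div_le_div_of_isCut {B : Finset (Fin P.numArcs)} (hB : P.graph.IsCut P.source P.sink B)
    {c : ℕ → ℕ} (hc : ∀ a ∈ B, (a : ℕ) % P.len = c (a / P.len)) {π π' : ℕ} (hπ : π < 2 * P.ℓ)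
    (hπ' : π' < 2 * P.ℓ) (hc' : c π' < P.len) (hseg : P.seg π = P.seg π')
    (hrep : P.rep π = P.rep π') : c π' / P.seg π ≤ c π / P.seg π := by
  by_contra! h
  -- The end of the segment in which `π` is cut. Following `π'` up to `b` and `π` from there avoids
  -- the cut, as `c π < b ≤ c π'`.
  set b := (c π / P.seg π + 1) * P.seg π with hb
  have hb' : b ≤ c π' := (Nat.le_div_iff_mul_le (P.seg_pos π)).1 h
  have hb₀ : 0 < b := Nat.mul_pos (Nat.succ_pos _) (P.seg_pos π)
  have hb₁ : c π < b := by
    rw [hb, mul_comm]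
    exact Nat.lt_mul_div_succ _ (P.seg_pos π)
  have hb₂ : b ≤ P.len := hb'.trans hc'.le
  obtain ⟨l₁, w₁, h₁⟩ := P.exists_isWalk hπ' (Nat.zero_le b) hb₂
  obtain ⟨l₂, w₂, h₂⟩ := P.exists_isWalk hπ hb₂ le_rfl
  have e : P.vertex π' b = P.vertex π b := by
    have hm : b % P.seg π = 0 := by rw [hb]; exact Nat.mul_mod_left _ _
    have hm' : b % P.seg π' = 0 := hseg ▸ hm
    simp only [vertex, hm, hm', hrep, if_true]
  have e₀ : P.vertex π' 0 = 0 := by simp [vertex]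
  have e₁ : P.vertex π P.len = 1 := by simp [vertex, P.len_pos.ne']
  simp only [e, e₀] at w₁
  simp only [e₁] at w₂
  obtain ⟨a, ha, haB⟩ := hB _ (P.isWalk_append w₁ w₂)
  have hac := hc a haB
  rcases List.mem_append.1 ha with ha | ha
  · obtain ⟨h₃, -, h₄⟩ := h₁ a ha
    rw [h₃] at hac
    omega
  · obtain ⟨h₃, h₄, -⟩ := h₂ a ha
    rw [h₃] at hac
    omega

/-- At most `2ℓ` arcs have to hit `2ℓ` arc-disjoint paths, so each path contains exactly one cut
arc. A pair within one path would place two there, hence by `hside` the pairs match path `π` with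
path `π + ℓ`. -/
theorem hasPairedCut_iff (mate : Fin P.numArcs → Fin P.numArcs) (hmate : ∀ a, mate (mate a) = a)
    (hne : ∀ a, mate a ≠ a) (hside : ∀ a : Fin P.numArcs, (a : ℕ) / P.len < P.ℓ →
      (mate a : ℕ) / P.len = a / P.len ∨ (mate a : ℕ) / P.len = a / P.len + P.ℓ) :
    (P.toInstance mate hmate hne).HasPairedCut ↔ ∃ (c : ℕ → ℕ) (hc : ∀ π < 2 * P.ℓ, c π < P.len),
      (∀ π π', π < 2 * P.ℓ → π' < 2 * P.ℓ → P.seg π = P.seg π' → P.rep π = P.rep π' →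
        c π / P.seg π = c π' / P.seg π) ∧
      ∀ (π : ℕ) (hπ : π < P.ℓ), (mate (P.arc π (c π) (by omega) (hc π (by omega))) : ℕ) =
        (π + P.ℓ) * P.len + c (π + P.ℓ) := by
  constructor
  · rintro ⟨(F : Finset (Finset (Fin P.numArcs))), hF, hcard, hcut⟩
    set B : Finset (Fin P.numArcs) := F.biUnion id with hBdef
    replace hcut : P.graph.IsCut P.source P.sink B := hcut
    have hpair : ∀ X ∈ F, ∃ b : Fin P.numArcs, X = ({b, mate b} : Finset (Fin P.numArcs)) := by
      intro X hX
      obtain ⟨b, -, hb⟩ := Finset.mem_image.1 (hF hX)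
      exact ⟨b, hb.symm⟩
    have hmateB : ∀ a ∈ B, mate a ∈ B := by
      intro a ha
      obtain ⟨X, hX, haX⟩ := Finset.mem_biUnion.1 ha
      obtain ⟨b, hb⟩ := hpair X hX
      refine Finset.mem_biUnion.2 ⟨X, hX, ?_⟩
      change a ∈ X at haX
      change mate a ∈ X
      rw [hb, Finset.mem_insert, Finset.mem_singleton] at haX ⊢
      rcases haX with rfl | rfl
      · exact Or.inr rfl
      · exact Or.inl (hmate b)
    have hBcard : B.card ≤ 2 * P.ℓ := by
      refine (Finset.card_biUnion_le_card_mul F id 2 fun X hX => ?_).trans ?_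
      · obtain ⟨b, hb⟩ := hpair X hX
        exact (congrArg Finset.card hb).trans_le Finset.card_le_two
      · rw [mul_comm]; exact Nat.mul_le_mul_left 2 hcard
    have hsurj : ∀ π : Fin (2 * P.ℓ), ∃ a ∈ B, (a : ℕ) / P.len = π := by
      intro π
      obtain ⟨a, ha, haB⟩ := hcut _ ((P.toInstance mate hmate hne).path_isWalk π)
      exact ⟨a, haB, (P.mem_path π a).1 ha⟩
    let pr : Fin P.numArcs → Fin (2 * P.ℓ) := fun a => ⟨a / P.len, P.div_lt a⟩
    have himg : B.image pr = Finset.univ := by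
      refine Finset.eq_univ_of_forall fun π => ?_
      obtain ⟨a, haB, ha⟩ := hsurj π
      exact Finset.mem_image.2 ⟨a, haB, Fin.ext ha⟩
    -- A surjection from at most `2ℓ` arcs onto `2ℓ` paths is injective.
    have hinj : Set.InjOn pr B := by
      refine Finset.card_image_iff.1 (le_antisymm Finset.card_image_le ?_)
      rw [himg, Finset.card_univ, Fintype.card_fin]
      exact hBcard
    choose g hgB hg using hsurj
    let c : ℕ → ℕ := fun π => if h : π < 2 * P.ℓ then (g ⟨π, h⟩ : ℕ) % P.len else 0
    have hcB : ∀ a ∈ B, (a : ℕ) % P.len = c (a / P.len) := by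
      intro a ha
      simp only [c, P.div_lt a, dif_pos]
      rw [← hinj ha (hgB _) (Fin.ext (hg ⟨a / P.len, P.div_lt a⟩).symm)]
    have hc : ∀ π < 2 * P.ℓ, c π < P.len := fun π hπ => by
      simp only [c, hπ, dif_pos]; exact P.mod_lt _
    refine ⟨c, hc, fun π π' hπ hπ' hs hr => le_antisymm ?_ ?_, fun π hπ => ?_⟩
    · rw [hs]
      exact P.div_le_div_of_isCut hcut hcB hπ' hπ (hc π hπ) hs.symm hr.symm
    · exact P.div_le_div_of_isCut hcut hcB hπ hπ' (hc π' hπ') hs hr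
    · have hπ' : π < 2 * P.ℓ := by omega
      set a := P.arc π (c π) hπ' (hc π hπ') with ha
      have hdiv : (a : ℕ) / P.len = π := mul_add_div _ (hc π hπ')
      have haB : a ∈ B := by
        have : g ⟨π, hπ'⟩ = a := by
          refine Fin.ext ?_
          have h₁ := hg ⟨π, hπ'⟩
          have h₂ : c π = (g ⟨π, hπ'⟩ : ℕ) % P.len := by simp only [c, hπ', dif_pos]
          have h₃ := Nat.div_add_mod (g ⟨π, hπ'⟩ : ℕ) P.len
          rw [h₁, ← h₂] at h₃
          rw [← h₃, ha, arc, mul_comm]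
        exact this ▸ hgB _
      have hmB := hmateB a haB
      have hdm : (mate a : ℕ) / P.len = π + P.ℓ := by
        rcases hside a (by omega) with h | h
        -- A mate on the same path would be a second cut arc of that path.
        · exact absurd (hinj hmB haB (Fin.ext h)) (hne a)
        · omega
      have h₁ := hcB _ hmB
      have h₂ := Nat.div_add_mod (mate a : ℕ) P.len
      rw [h₁, hdm] at h₂
      rw [← h₂, mul_comm]
  · rintro ⟨c, hc, hcons, hm⟩
    let X : Fin P.ℓ → Finset (Fin P.numArcs) := fun π =>
      {P.arc π (c π) (by omega) (hc π (by omega)), mate (P.arc π (c π) (by omega) (hc π (by omega)))}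
    refine ⟨Finset.univ.image X, ?_, ?_, ?_⟩
    · intro Y hY
      obtain ⟨π, -, rfl⟩ := Finset.mem_image.1 hY
      exact Finset.mem_image.2 ⟨_, Finset.mem_univ _, rfl⟩
    · exact Finset.card_image_le.trans (by simp [toInstance])
    · refine P.isCut_of_consistent c hc (fun π hπ => ?_) _ fun a ha => ?_
      · exact hcons π _ hπ (P.rep_lt π hπ) (P.seg_rep π hπ).symm (P.rep_rep π hπ).symm
      · have hdm := Nat.div_add_mod (a : ℕ) P.len
        rw [ha, mul_comm] at hdm
        have hlt := P.div_lt a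
        by_cases h : (a : ℕ) / P.len < P.ℓ
        · refine Finset.mem_biUnion.2 ⟨X ⟨a / P.len, h⟩,
            Finset.mem_image.2 ⟨_, Finset.mem_univ _, rfl⟩, ?_⟩
          refine Finset.mem_insert.2 (Or.inl (Fin.ext hdm.symm))
        · have h' : (a : ℕ) / P.len - P.ℓ < P.ℓ := by omega
          refine Finset.mem_biUnion.2 ⟨X ⟨a / P.len - P.ℓ, h'⟩,
            Finset.mem_image.2 ⟨_, Finset.mem_univ _, rfl⟩, ?_⟩
          refine Finset.mem_insert.2 (Or.inr (Finset.mem_singleton.2 (Fin.ext ?_)))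
          have := hm _ h'
          rw [Nat.sub_add_cancel (by omega)] at this
          exact hdm.symm.trans this.symm

end PathSystem

/-! ### Binary constraints between two families of variables -/

/-- Constraints between `nI` variables with values below `nV` and `nT` variables with values
below `nW`. -/
structure ConstraintGrid where
  nI : ℕ
  nT : ℕ
  nV : ℕ
  nW : ℕ
  nI_pos : 0 < nI
  nT_pos : 0 < nT
  nV_pos : 0 < nV
  nW_pos : 0 < nW
  compat : ℕ → ℕ → ℕ → ℕ → Bool

namespace ConstraintGrid

open PathSystem

variable (G : ConstraintGrid)

/-- Two families of bundles of paths, with a pair of paths for every constraint. -/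
def system : PathSystem where
  ℓ := G.nI * G.nT
  len := 2 * (G.nV * G.nW)
  -- Positions are `2 * (v * nW + w) + e` on the left and `2 * (w * nV + v) + e` on the right, so a
  -- segment fixes `v` or `w`, respectively.
  seg π := if π < G.nI * G.nT then 2 * G.nW else 2 * G.nV
  -- Left paths are joined for equal `i`, right paths for equal `τ`, where `π` is `i * nT + τ`,
  -- shifted by `ℓ` on the right.
  rep π := if π < G.nI * G.nT then π / G.nT * G.nT else G.nI * G.nT + (π - G.nI * G.nT) % G.nT
  len_pos := Nat.mul_pos two_pos (Nat.mul_pos G.nV_pos G.nW_pos)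
  seg_pos π := by
    have := G.nV_pos
    have := G.nW_pos
    split_ifs <;> omega
  rep_lt π hπ := by
    have h₁ := Nat.div_mul_le_self π G.nT
    have h₂ := Nat.mod_lt (π - G.nI * G.nT) G.nT_pos
    have h₃ : G.nT ≤ G.nI * G.nT := Nat.le_mul_of_pos_left _ G.nI_pos
    split_ifs <;> omega
  rep_rep π hπ := by
    have h₁ := Nat.div_mul_le_self π G.nT
    split_ifs with h₂ h₃ h₃
    · rw [Nat.mul_div_cancel _ G.nT_pos]
    · omega
    · omega
    · rw [Nat.add_sub_cancel_left, Nat.mod_mod]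
  seg_rep π hπ := by
    have h₁ := Nat.div_mul_le_self π G.nT
    split_ifs with h₂ h₃ h₃ <;> first | rfl | omega

/-- The arc that an arc is paired with. -/
def mateNat (a : ℕ) : ℕ :=
  let π := a / G.system.len
  let q := a % G.system.len / 2
  let ρ := π - G.system.ℓ
  -- Compatible values lead to the same values on the opposite path. Otherwise the partner is the
  -- arc of opposite parity on the same path; the parity exists only to provide it.
  if π < G.system.ℓ then
    if G.compat (π / G.nT) (π % G.nT) (q / G.nW) (q % G.nW) then
      (π + G.system.ℓ) * G.system.len + (2 * (q % G.nW * G.nV + q / G.nW) + a % 2)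
    else π * G.system.len + (2 * q + (1 - a % 2))
  else
    if G.compat (ρ / G.nT) (ρ % G.nT) (q % G.nV) (q / G.nV) then
      ρ * G.system.len + (2 * (q % G.nV * G.nW + q / G.nV) + a % 2)
    else π * G.system.len + (2 * q + (1 - a % 2))

variable {G}

theorem left_lt {v w e : ℕ} (hv : v < G.nV) (hw : w < G.nW) (he : e < 2) :
    2 * (v * G.nW + w) + e < G.system.len := by
  have := mul_add_lt hv hw
  simp only [system]
  omega

theorem right_lt {v w e : ℕ} (hv : v < G.nV) (hw : w < G.nW) (he : e < 2) :
    2 * (w * G.nV + v) + e < G.system.len := by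
  have := mul_add_lt hw hv
  rw [mul_comm G.nW] at this
  simp only [system]
  omega

theorem code_mod_two (π q : ℕ) {e : ℕ} (he : e < 2) : (π * G.system.len + (2 * q + e)) % 2 = e := by
  have : π * G.system.len = 2 * (π * (G.nV * G.nW)) := by simp only [system]; ring
  omega

theorem mateNat_left {π v w e : ℕ} (hπ : π < G.system.ℓ) (hv : v < G.nV) (hw : w < G.nW)
    (he : e < 2) : G.mateNat (π * G.system.len + (2 * (v * G.nW + w) + e)) =
      if G.compat (π / G.nT) (π % G.nT) v w then
        (π + G.system.ℓ) * G.system.len + (2 * (w * G.nV + v) + e)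
      else π * G.system.len + (2 * (v * G.nW + w) + (1 - e)) := by
  have h := left_lt hv hw he
  have hq : (2 * (v * G.nW + w) + e) / 2 = v * G.nW + w := by omega
  simp only [mateNat, mul_add_div π h, mul_add_mod π h, code_mod_two π _ he, hq, if_pos hπ,
    mul_add_div v hw, mul_add_mod v hw]

theorem mateNat_right {ρ v w e : ℕ} (hv : v < G.nV) (hw : w < G.nW)
    (he : e < 2) : G.mateNat ((ρ + G.system.ℓ) * G.system.len + (2 * (w * G.nV + v) + e)) =
      if G.compat (ρ / G.nT) (ρ % G.nT) v w then
        ρ * G.system.len + (2 * (v * G.nW + w) + e)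
      else (ρ + G.system.ℓ) * G.system.len + (2 * (w * G.nV + v) + (1 - e)) := by
  have h := right_lt hv hw he
  have hq : (2 * (w * G.nV + v) + e) / 2 = w * G.nV + v := by omega
  have hn : ¬ ρ + G.system.ℓ < G.system.ℓ := by omega
  simp only [mateNat, mul_add_div _ h, mul_add_mod _ h, code_mod_two _ _ he, hq, if_neg hn,
    mul_add_div w hv, mul_add_mod w hv, Nat.add_sub_cancel]

/-- Every arc has coordinates. -/
theorem exists_coordinates {a : ℕ} (ha : a < G.system.numArcs) : ∃ π v w e : ℕ, π < G.system.ℓ ∧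
    v < G.nV ∧ w < G.nW ∧ e < 2 ∧ (a = π * G.system.len + (2 * (v * G.nW + w) + e) ∨
      a = (π + G.system.ℓ) * G.system.len + (2 * (w * G.nV + v) + e)) := by
  have hπ := G.system.div_lt ⟨a, ha⟩
  have hm := G.system.mod_lt a
  have hd := Nat.div_add_mod a G.system.len
  rw [mul_comm] at hd
  simp only at hπ
  set π := a / G.system.len
  set p := a % G.system.len
  have hp : p = 2 * (p / 2) + p % 2 := by omega
  have hq : p / 2 < G.nV * G.nW := by
    have : G.system.len = 2 * (G.nV * G.nW) := rfl
    omega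
  by_cases h : π < G.system.ℓ
  · refine ⟨π, p / 2 / G.nW, p / 2 % G.nW, p % 2, h, Nat.div_lt_of_lt_mul (by rwa [mul_comm]),
      Nat.mod_lt _ G.nW_pos, Nat.mod_lt _ two_pos, Or.inl ?_⟩
    rw [mul_comm (p / 2 / G.nW), Nat.div_add_mod, ← hp, hd]
  · refine ⟨π - G.system.ℓ, p / 2 % G.nV, p / 2 / G.nV, p % 2, by omega, Nat.mod_lt _ G.nV_pos,
      Nat.div_lt_of_lt_mul hq, Nat.mod_lt _ two_pos, Or.inr ?_⟩
    rw [mul_comm (p / 2 / G.nV), Nat.div_add_mod, ← hp, Nat.sub_add_cancel (by omega), hd]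

/-- In coordinates, the map changes either only the side or only the parity. Which of these happens
depends on the constraint and on `v`, `w`, which both partners share. -/
theorem mateNat_spec {a : ℕ} (ha : a < G.system.numArcs) : G.mateNat a < G.system.numArcs ∧
    G.mateNat (G.mateNat a) = a ∧ G.mateNat a ≠ a := by
  obtain ⟨π, v, w, e, hπ, hv, hw, he, rfl | rfl⟩ := exists_coordinates ha
  · rw [mateNat_left hπ hv hw he]
    split_ifs with hc
    · refine ⟨mul_add_lt (by omega) (right_lt hv hw he), ?_, ?_⟩
      · rw [mateNat_right hv hw he, if_pos hc]
      · intro h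
        have h' := congrArg (· / G.system.len) h
        simp only [mul_add_div _ (right_lt hv hw he), mul_add_div _ (left_lt hv hw he)] at h'
        omega
    · have he' : 1 - e < 2 := by omega
      refine ⟨mul_add_lt (by omega) (left_lt hv hw he'), ?_, by omega⟩
      rw [mateNat_left hπ hv hw he', if_neg hc]
      omega
  · rw [mateNat_right hv hw he]
    split_ifs with hc
    · refine ⟨mul_add_lt (by omega) (left_lt hv hw he), ?_, ?_⟩
      · rw [mateNat_left hπ hv hw he, if_pos hc]
      · intro h
        have h' := congrArg (· / G.system.len) h
        simp only [mul_add_div _ (right_lt hv hw he), mul_add_div _ (left_lt hv hw he)] at h'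
        omega
    · have he' : 1 - e < 2 := by omega
      refine ⟨mul_add_lt (by omega) (right_lt hv hw he'), ?_, by omega⟩
      rw [mateNat_right hv hw he', if_neg hc]
      omega

variable (G)

/-- The pairing of the arcs. -/
def mate (a : Fin G.system.numArcs) : Fin G.system.numArcs := ⟨G.mateNat a, (mateNat_spec a.2).1⟩

theorem mate_mate (a : Fin G.system.numArcs) : G.mate (G.mate a) = a :=
  Fin.ext (mateNat_spec a.2).2.1

theorem mate_ne (a : Fin G.system.numArcs) : G.mate a ≠ a := fun h =>
  (mateNat_spec a.2).2.2 (congrArg Fin.val h)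

/-- The instance of the paired minimum cut problem for the constraints. -/
def toPairedCut : PairedCutInstance := G.system.toInstance G.mate G.mate_mate G.mate_ne

theorem mate_side (a : Fin G.system.numArcs) (ha : (a : ℕ) / G.system.len < G.system.ℓ) :
    (G.mate a : ℕ) / G.system.len = a / G.system.len ∨
      (G.mate a : ℕ) / G.system.len = a / G.system.len + G.system.ℓ := by
  obtain ⟨π, v, w, e, hπ, hv, hw, he, h | h⟩ := exists_coordinates a.2
  · simp only [mate, h, mateNat_left hπ hv hw he]
    rw [mul_add_div _ (left_lt hv hw he)]
    split_ifs
    · exact Or.inr (mul_add_div _ (right_lt hv hw he))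
    · exact Or.inl (mul_add_div _ (left_lt hv hw (by omega)))
  · rw [h, mul_add_div _ (right_lt hv hw he)] at ha
    omega

/-- The common segments make `v` a function of `i` and `w` a function of `τ`; the pairing makes both
paths of a constraint carry the same compatible values. -/
theorem hasPairedCut_toPairedCut_iff : G.toPairedCut.HasPairedCut ↔ ∃ x y : ℕ → ℕ,
    (∀ i < G.nI, x i < G.nV) ∧ (∀ τ < G.nT, y τ < G.nW) ∧
      ∀ i < G.nI, ∀ τ < G.nT, G.compat i τ (x i) (y τ) = true := by
  have hℓ : G.system.ℓ = G.nI * G.nT := rfl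
  have hlen : G.system.len = 2 * (G.nV * G.nW) := rfl
  have hseg₀ : ∀ π < G.system.ℓ, G.system.seg π = 2 * G.nW := fun π h => if_pos h
  have hseg₁ : ∀ π, G.system.seg (π + G.system.ℓ) = 2 * G.nV := fun π => if_neg (by omega)
  have hrep₀ : ∀ i < G.nI, ∀ τ < G.nT, G.system.rep (i * G.nT + τ) = i * G.nT := fun i hi τ hτ =>
    (if_pos (mul_add_lt hi hτ)).trans (by rw [mul_add_div i hτ])
  have hrep₁ : ∀ i, ∀ τ < G.nT, G.system.rep (i * G.nT + τ + G.system.ℓ) = G.system.ℓ + τ :=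
    fun i τ hτ => (if_neg (by omega)).trans (by
      rw [← hℓ, Nat.add_sub_cancel, mul_add_mod i hτ])
  rw [toPairedCut, G.system.hasPairedCut_iff _ _ _ G.mate_side]
  constructor
  · rintro ⟨c, hc, hcons, hm⟩
    -- The values are read off the left paths with `τ = 0` and the right paths with `i = 0`.
    refine ⟨fun i => c (i * G.nT) / (2 * G.nW), fun τ => c (τ + G.system.ℓ) / (2 * G.nV),
      fun i hi => ?_, fun τ hτ => ?_, fun i hi τ hτ => ?_⟩
    · have := mul_add_lt hi G.nT_pos
      refine Nat.div_lt_of_lt_mul ((hc _ (by omega)).trans_eq ?_)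
      rw [hlen]; ring
    · have := mul_add_lt G.nI_pos hτ
      refine Nat.div_lt_of_lt_mul ((hc _ (by omega)).trans_eq ?_)
      rw [hlen]; ring
    · dsimp only
      have hπ : i * G.nT + τ < G.system.ℓ := mul_add_lt hi hτ
      have hπ₀ : i * G.nT < G.system.ℓ := by omega
      have hτ' : τ < G.system.ℓ := by have := mul_add_lt G.nI_pos hτ; omega
      have e₀ : c (i * G.nT) / (2 * G.nW) = c (i * G.nT + τ) / (2 * G.nW) := by
        have := hcons (i * G.nT) (i * G.nT + τ) (by omega) (by omega)
          (by rw [hseg₀ _ hπ₀, hseg₀ _ hπ]) (by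
            rw [hrep₀ i hi τ hτ]; simpa using hrep₀ i hi 0 G.nT_pos)
        rwa [hseg₀ _ hπ₀] at this
      have e₁ : c (τ + G.system.ℓ) / (2 * G.nV) = c (i * G.nT + τ + G.system.ℓ) / (2 * G.nV) := by
        have := hcons (τ + G.system.ℓ) (i * G.nT + τ + G.system.ℓ) (by omega) (by omega)
          (by rw [hseg₁, hseg₁]) (by
            rw [hrep₁ i τ hτ]; simpa using hrep₁ 0 τ hτ)
        rwa [hseg₁] at this
      rw [e₀, e₁]
      have hmπ := hm _ hπ
      obtain ⟨π', v, w, e, hπ', hv, hw, he, h | h⟩ :=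
        exists_coordinates (G.system.arc (i * G.nT + τ) _ (by omega) (hc (i * G.nT + τ) (by omega))).2
      · simp only [arc] at h
        have hd := congrArg (· / G.system.len) h
        have hp := congrArg (· % G.system.len) h
        simp only [mul_add_div _ (left_lt hv hw he), mul_add_mod _ (left_lt hv hw he),
          mul_add_div _ (hc _ (show i * G.nT + τ < 2 * G.system.ℓ by omega)),
          mul_add_mod _ (hc _ (show i * G.nT + τ < 2 * G.system.ℓ by omega))] at hd hp
        subst hd
        simp only [mate, arc, hp, mateNat_left hπ hv hw he, mul_add_div i hτ,
          mul_add_mod i hτ] at hmπ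
        have hcπ := hc (i * G.nT + τ + G.system.ℓ) (by omega)
        split_ifs at hmπ with hcompat
        · have hp' := congrArg (· % G.system.len) hmπ
          simp only [mul_add_mod _ (right_lt hv hw he), mul_add_mod _ hcπ] at hp'
          rw [hp, ← hp', ← Nat.div_div_eq_div_mul, ← Nat.div_div_eq_div_mul,
            show (2 * (v * G.nW + w) + e) / 2 = v * G.nW + w by omega,
            show (2 * (w * G.nV + v) + e) / 2 = w * G.nV + v by omega,
            mul_add_div v hw, mul_add_div w hv]
          exact hcompat
        -- For incompatible values the mate stays on the left path, although it should lie on the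
        -- right one.
        · have hd' := congrArg (· / G.system.len) hmπ
          simp only [mul_add_div _ (left_lt hv hw (show 1 - e < 2 by omega)),
            mul_add_div _ hcπ] at hd'
          omega
      · simp only [arc] at h
        have hd := congrArg (· / G.system.len) h
        simp only [mul_add_div _ (right_lt hv hw he),
          mul_add_div _ (hc _ (show i * G.nT + τ < 2 * G.system.ℓ by omega))] at hd
        omega
  · rintro ⟨x, y, hx, hy, hxy⟩
    have hdiv : ∀ π < G.system.ℓ, π / G.nT < G.nI := fun π hπ =>
      Nat.div_lt_of_lt_mul (by rw [mul_comm]; exact hπ)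
    have hmod : ∀ π, π % G.nT < G.nT := fun π => Nat.mod_lt _ G.nT_pos
    -- Parity `0` is chosen on all paths; the pairing across preserves it.
    let c : ℕ → ℕ := fun π => if π < G.system.ℓ then 2 * (x (π / G.nT) * G.nW + y (π % G.nT))
      else 2 * (y ((π - G.system.ℓ) % G.nT) * G.nV + x ((π - G.system.ℓ) / G.nT))
    have hc₀ : ∀ π < G.system.ℓ, c π = 2 * (x (π / G.nT) * G.nW + y (π % G.nT)) :=
      fun π h => if_pos h
    have hc₁ : ∀ π, c (π + G.system.ℓ) = 2 * (y (π % G.nT) * G.nV + x (π / G.nT)) :=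
      fun π => (if_neg (by omega)).trans (by rw [Nat.add_sub_cancel])
    have hc : ∀ π < 2 * G.system.ℓ, c π < G.system.len := by
      intro π hπ
      by_cases h : π < G.system.ℓ
      · rw [hc₀ π h]
        exact left_lt (e := 0) (hx _ (hdiv π h)) (hy _ (hmod π)) two_pos
      · obtain ⟨ρ, rfl⟩ := Nat.exists_eq_add_of_le' (not_lt.1 h)
        rw [hc₁]
        exact right_lt (e := 0) (hx _ (hdiv ρ (by omega))) (hy _ (hmod ρ)) two_pos
    have hval : ∀ π < 2 * G.system.ℓ, c π / G.system.seg π =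
        if π < G.system.ℓ then x (G.system.rep π / G.nT)
          else y (G.system.rep π - G.system.ℓ) := by
      intro π hπ
      by_cases h : π < G.system.ℓ
      · rw [if_pos h, hc₀ π h, hseg₀ π h, Nat.mul_div_mul_left _ _ two_pos,
          mul_add_div _ (hy _ (hmod π))]
        have := hrep₀ _ (hdiv π h) _ (hmod π)
        rw [mul_comm, Nat.div_add_mod, mul_comm] at this
        rw [this, Nat.mul_div_cancel _ G.nT_pos]
      · obtain ⟨ρ, rfl⟩ := Nat.exists_eq_add_of_le' (not_lt.1 h)
        have hρ : ρ < G.system.ℓ := by omega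
        rw [if_neg h, hc₁, hseg₁, Nat.mul_div_mul_left _ _ two_pos, mul_add_div _ (hx _ (hdiv ρ hρ))]
        have := hrep₁ (ρ / G.nT) _ (hmod ρ)
        rw [mul_comm, Nat.div_add_mod] at this
        rw [this, Nat.add_sub_cancel_left]
    refine ⟨c, hc, fun π π' hπ hπ' hs hr => ?_, fun π hπ => ?_⟩
    · have h₁ := hval π hπ
      have h₂ := hval π' hπ'
      rw [hs] at h₁ ⊢
      rw [h₁, h₂, hr]
      -- Representatives stay on their side, which excludes the mixed cases even when the two
      -- segment lengths coincide.
      have hr₀ : ∀ π, π < G.system.ℓ → G.system.rep π < G.system.ℓ := fun π h => by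
        have h' : G.system.rep π = π / G.nT * G.nT := if_pos h
        have := Nat.div_mul_le_self π G.nT
        omega
      have hr₁ : ∀ π, ¬ π < G.system.ℓ → ¬ G.system.rep π < G.system.ℓ := fun π h => by
        have h' : G.system.rep π = G.nI * G.nT + (π - G.nI * G.nT) % G.nT := if_neg h
        omega
      by_cases h : π < G.system.ℓ <;> by_cases h' : π' < G.system.ℓ <;> simp only [h, h', if_true, if_false]
      · have := hr₀ π h; have := hr₁ π' h'; omega
      · have := hr₁ π h; have := hr₀ π' h'; omega
    · have hv := hx _ (hdiv π hπ)
      have hw := hy _ (hmod π)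
      have := mateNat_left (e := 0) hπ hv hw two_pos
      rw [if_pos (hxy _ (hdiv π hπ) _ (hmod π))] at this
      simp only [mate, arc, hc₀ π hπ, hc₁]
      exact this

end ConstraintGrid

/-! ### Weighted satisfiability as a constraint grid -/

namespace WeightedCNF

variable {q : ℕ} (φ : WeightedCNF q)

/-- The literal is false if `a < b` are consecutive elements of a set of true variables, where
the variables are numbered from `1`. -/
def Falsified {n : ℕ} (L : Fin n × Bool) (a b : ℕ) : Prop :=
  if L.2 = true then a < L.1 + 1 ∧ (L.1 : ℕ) + 1 < b else a = L.1 + 1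

/-- The first component of entry `p` in a list of pairs, which is coded by `w`. -/
def lower (w p : ℕ) : ℕ := w / (φ.numVars + 2) ^ (2 * p) % (φ.numVars + 2)

/-- The second component of entry `p` in a list of pairs, which is coded by `w`. -/
def upper (w p : ℕ) : ℕ := w / (φ.numVars + 2) ^ (2 * p + 1) % (φ.numVars + 2)

/-- The entry `p` of the list of indices that is coded by `τ`. -/
def index (τ p : ℕ) : ℕ := τ / (φ.weight + 1) ^ p % (φ.weight + 1)

/-- The value `v` of element `i` of an increasing sequence of true variables is compatible with
the values `w` of the elements `index τ p` and `index τ p + 1`, and the latter do not falsify a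
clause. -/
def Compatible (i τ v w : ℕ) : Prop :=
  (i = 0 → v = 0) ∧ (i = φ.weight + 1 → v = φ.numVars + 1) ∧
  (∀ p < q + 1, φ.lower w p < φ.upper w p ∧ (φ.index τ p = i → φ.lower w p = v) ∧
    (φ.index τ p + 1 = i → φ.upper w p = v)) ∧
  ∀ C ∈ φ.clauses, ∃ (m : ℕ) (h : m < C.length),
    ¬ Falsified C[m] (φ.lower w m) (φ.upper w m)

open Classical in
/-- The constraint grid of a formula. -/
noncomputable def grid : ConstraintGrid where
  nI := φ.weight + 2
  -- One index more than a clause has literals: even for `q = 0` every single index must occur,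
  -- since `x j < x (j + 1)` is tested through it.
  nT := (φ.weight + 1) ^ (q + 1)
  nV := φ.numVars + 2
  nW := (φ.numVars + 2) ^ (2 * (q + 1))
  nI_pos := by omega
  nT_pos := by positivity
  nV_pos := by omega
  nW_pos := by positivity
  compat i τ v w := decide (φ.Compatible i τ v w)

theorem exists_digits {b n : ℕ} (f : ℕ → ℕ) (hf : ∀ r < n, f r < b) :
    ∃ a < b ^ n, ∀ r < n, a / b ^ r % b = f r := by
  let g : Fin n → Fin b := fun r => ⟨f r, hf r r.2⟩
  refine ⟨finFunctionFinEquiv g, (finFunctionFinEquiv g).2, fun r hr => ?_⟩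
  rw [← finFunctionFinEquiv_symm_apply_val (finFunctionFinEquiv g) ⟨r, hr⟩,
    Equiv.symm_apply_apply]

theorem lt_of_consecutive {x : ℕ → ℕ} {k : ℕ} (hx : ∀ j ≤ k, x j < x (j + 1)) {i j : ℕ}
    (hij : i < j) (hj : j ≤ k + 1) : x i < x j := by
  induction j, hij using Nat.le_induction with
  | base => exact hx i (by omega)
  | succ j _ ih => exact (ih (by omega)).trans (hx j (by omega))

theorem lt_of_lt_of_consecutive {x : ℕ → ℕ} {k : ℕ} (hx : ∀ j ≤ k, x j < x (j + 1)) {i j : ℕ}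
    (h : x i < x j) (hi : i ≤ k + 1) : i < j := by
  by_contra! hji
  rcases hji.eq_or_lt with rfl | hji
  · omega
  · have := lt_of_consecutive hx hji hi
    omega

/-- With the sentinels, every false variable lies in a gap between consecutive terms, also before
the first and after the last true variable. -/
theorem exists_increasing {S : Finset (Fin φ.numVars)} (hS : S.card = φ.weight) : ∃ x : ℕ → ℕ,
    x 0 = 0 ∧ x (φ.weight + 1) = φ.numVars + 1 ∧ (∀ j, x j < φ.numVars + 2) ∧
    (∀ j ≤ φ.weight, x j < x (j + 1)) ∧
    ∀ u : Fin φ.numVars, u ∈ S ↔ ∃ j, 1 ≤ j ∧ j ≤ φ.weight ∧ x j = u + 1 := by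
  let e := S.orderEmbOfFin hS
  let x : ℕ → ℕ := fun j => if j = 0 then 0 else
    if h : j - 1 < φ.weight then (e ⟨j - 1, h⟩ : ℕ) + 1 else φ.numVars + 1
  have hx : ∀ j (h : j < φ.weight), x (j + 1) = (e ⟨j, h⟩ : ℕ) + 1 := by
    intro j h
    simp [x, h]
  have hk : x (φ.weight + 1) = φ.numVars + 1 := by simp [x]
  refine ⟨x, by simp [x], hk, fun j => ?_, fun j hj => ?_, fun u => ?_⟩
  · simp only [x]
    split_ifs
    · omega
    · omega
    · omega
  · rcases hj.eq_or_lt with rfl | hj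
    · rw [hk]
      rcases Nat.eq_zero_or_pos φ.weight with h | h
      · simp [x, h]
      · obtain ⟨j, hj⟩ := Nat.exists_eq_add_of_le' h
        rw [hj, hx j (by omega)]
        omega
    · rw [hx j hj]
      rcases j with _ | j
      · simp [x]
      · rw [hx j (by omega)]
        have : e ⟨j, by omega⟩ < e ⟨j + 1, hj⟩ := e.strictMono (by simp)
        have : (e ⟨j, by omega⟩ : ℕ) < e ⟨j + 1, hj⟩ := this
        omega
  · have hr : u ∈ S ↔ u ∈ Set.range e := by
      rw [Finset.range_orderEmbOfFin]; rfl
    rw [hr]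
    constructor
    · rintro ⟨j, rfl⟩
      exact ⟨j + 1, by omega, j.2, hx j j.2⟩
    · rintro ⟨j, h₁, h₂, h₃⟩
      obtain ⟨j, rfl⟩ := Nat.exists_eq_add_of_le' h₁
      rw [hx j h₂] at h₃
      exact ⟨⟨j, h₂⟩, Fin.ext (by omega)⟩

/-- Consistency forces `y τ` to list the pairs `(x j, x (j + 1))` at the indices coded by `τ`, so
the inner terms of `x` form a set of size `weight`. If it violated a clause, every literal would be
falsified by some pair, and the `τ` that collects these indices would contradict compatibility. -/
theorem hasWeightedSolution_of_compatible {x y : ℕ → ℕ}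
    (h : ∀ i < φ.weight + 2, ∀ τ < (φ.weight + 1) ^ (q + 1), φ.Compatible i τ (x i) (y τ)) :
    φ.HasWeightedSolution := by
  have hpos : 0 < (φ.weight + 1) ^ (q + 1) := by positivity
  have hidx : ∀ τ p, φ.index τ p < φ.weight + 1 := fun τ p => Nat.mod_lt _ (by omega)
  have hlo : ∀ τ < (φ.weight + 1) ^ (q + 1), ∀ p < q + 1, φ.lower (y τ) p = x (φ.index τ p) :=
    fun τ hτ p hp => ((h _ (by have := hidx τ p; omega) τ hτ).2.2.1 p hp).2.1 rfl
  have hup : ∀ τ < (φ.weight + 1) ^ (q + 1), ∀ p < q + 1,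
      φ.upper (y τ) p = x (φ.index τ p + 1) :=
    fun τ hτ p hp => ((h _ (by have := hidx τ p; omega) τ hτ).2.2.1 p hp).2.2 rfl
  have h₀ : x 0 = 0 := (h 0 (by omega) 0 hpos).1 rfl
  have h₁ : x (φ.weight + 1) = φ.numVars + 1 := (h _ (by omega) 0 hpos).2.1 rfl
  have hx : ∀ j ≤ φ.weight, x j < x (j + 1) := by
    intro j hj
    have hj' : j < (φ.weight + 1) ^ (q + 1) :=
      (show j < φ.weight + 1 by omega).trans_le (Nat.le_self_pow (by omega) _)
    -- The number `j`, read as a list of indices, has `j` as its first entry.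
    have h₂ : φ.index j 0 = j := by simp [index]; omega
    have h₃ := ((h 0 (by omega) j hj').2.2.1 0 (by omega)).1
    rwa [hlo j hj' 0 (by omega), hup j hj' 0 (by omega), h₂] at h₃
  have hb : ∀ j < φ.weight, 0 < x (j + 1) ∧ x (j + 1) < φ.numVars + 1 := fun j hj => by
    have h₂ := lt_of_consecutive hx (show 0 < j + 1 by omega) (by omega)
    have h₃ := lt_of_consecutive hx (show j + 1 < φ.weight + 1 by omega) le_rfl
    omega
  let e : Fin φ.weight → Fin φ.numVars := fun j => ⟨x (j + 1) - 1, by have := hb j j.2; omega⟩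
  have hinj : Function.Injective e := by
    intro i j hij
    have h₂ : x (i + 1) - 1 = x (j + 1) - 1 := congrArg Fin.val hij
    have h₃ := hb i i.2
    have h₄ := hb j j.2
    by_contra hne
    rcases lt_or_gt_of_ne hne with hlt | hlt
    · have := lt_of_consecutive hx (show (i : ℕ) + 1 < j + 1 from Nat.succ_lt_succ hlt) (by omega)
      omega
    · have := lt_of_consecutive hx (show (j : ℕ) + 1 < i + 1 from Nat.succ_lt_succ hlt) (by omega)
      omega
  have hmem : ∀ u : Fin φ.numVars, u ∈ Finset.univ.image e ↔
      ∃ j, 1 ≤ j ∧ j ≤ φ.weight ∧ x j = u + 1 := by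
    intro u
    rw [Finset.mem_image]
    constructor
    · rintro ⟨j, -, rfl⟩
      have := hb j j.2
      exact ⟨j + 1, by omega, j.2, by simp only [e]; omega⟩
    · rintro ⟨j, h₂, h₃, h₄⟩
      obtain ⟨j, rfl⟩ := Nat.exists_eq_add_of_le' h₂
      exact ⟨⟨j, h₃⟩, Finset.mem_univ _, Fin.ext (by simp only [e]; omega)⟩
  refine ⟨Finset.univ.image e, ?_, fun C hC => ?_⟩
  · rw [Finset.card_image_of_injective _ hinj, Finset.card_univ, Fintype.card_fin]
  · by_contra! hCf
    have hfals : ∀ m, ∃ j, j < φ.weight + 1 ∧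
        ∀ hm : m < C.length, Falsified C[m] (x j) (x (j + 1)) := by
      intro m
      by_cases hm : m < C.length
      · have hL := hCf C[m] (List.getElem_mem hm)
        suffices hs : ∃ j, j < φ.weight + 1 ∧ Falsified C[m] (x j) (x (j + 1)) by
          obtain ⟨j, h₂, h₃⟩ := hs
          exact ⟨j, h₂, fun _ => h₃⟩
        generalize C[m] = L at hL ⊢
        obtain ⟨u, b⟩ := L
        cases b with
        | true =>
            have hu : u ∉ Finset.univ.image e := by simpa using hL
            rw [hmem] at hu
            push Not at hu
            -- The last term below `u + 1`. Since `u` is false, `u + 1` is not a term and lies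
            -- strictly before the next one, possibly the final sentinel.
            set j := Nat.findGreatest (fun j => x j < u + 1) φ.weight with hj
            have hjk : j ≤ φ.weight := Nat.findGreatest_le _
            have hj₁ : x j < u + 1 :=
              Nat.findGreatest_spec (P := fun j => x j < u + 1) (Nat.zero_le _) (by omega)
            have hun := u.2
            have hj₂ : ¬ x (j + 1) < u + 1 := by
              rcases hjk.eq_or_lt with hk | hk
              · rw [hk, h₁]; omega
              · exact Nat.findGreatest_is_greatest (P := fun j => x j < u + 1) (Nat.lt_succ_self j) hk
            have hj₃ : x (j + 1) ≠ u + 1 := by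
              rcases hjk.eq_or_lt with hk | hk
              · rw [hk, h₁]; omega
              · exact hu (j + 1) (by omega) hk
            refine ⟨j, by omega, ?_⟩
            simp only [Falsified, if_true]
            omega
        | false =>
            have hu : u ∈ Finset.univ.image e := by simpa using hL
            obtain ⟨j, -, hj, hju⟩ := (hmem u).1 hu
            exact ⟨j, by omega, by simpa [Falsified] using hju⟩
      -- Positions behind the end of the clause get an arbitrary index.
      · exact ⟨0, by omega, fun h => absurd h hm⟩
    choose J hJ hJf using hfals
    obtain ⟨τ, hτ, hdig⟩ := exists_digits (n := q + 1) J (fun r _ => hJ r)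
    obtain ⟨m, hm, hn⟩ := (h 0 (by omega) τ hτ).2.2.2 C hC
    have hmq : m < q + 1 := by have := φ.width C hC; omega
    have hd : φ.index τ m = J m := hdig m hmq
    rw [hlo τ hτ m hmq, hup τ hτ m hmq, hd] at hn
    exact hn (hJf m hm)

/-- Let `y τ` record the actual pairs. No consecutive pair falsifies a true literal, so any true
literal of a clause serves as witness, whatever `τ` is. -/
theorem exists_compatible (h : φ.HasWeightedSolution) : ∃ x y : ℕ → ℕ,
    (∀ i, x i < φ.numVars + 2) ∧ (∀ τ, y τ < (φ.numVars + 2) ^ (2 * (q + 1))) ∧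
    ∀ i < φ.weight + 2, ∀ τ, φ.Compatible i τ (x i) (y τ) := by
  obtain ⟨S, hS, hsat⟩ := h
  obtain ⟨x, h₀, h₁, hb, hx, hmem⟩ := φ.exists_increasing hS
  -- Digits `2 * p` and `2 * p + 1` hold pair `p`: `r / 2` selects the pair, and `r % 2` the element
  -- or its successor.
  have hdig : ∀ τ, ∃ a < (φ.numVars + 2) ^ (2 * (q + 1)), ∀ r < 2 * (q + 1),
      a / (φ.numVars + 2) ^ r % (φ.numVars + 2) = x (φ.index τ (r / 2) + r % 2) :=
    fun τ => exists_digits _ fun r _ => hb _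
  choose y hy hyd using hdig
  have hidx : ∀ τ p, φ.index τ p < φ.weight + 1 := fun τ p => Nat.mod_lt _ (by omega)
  have hlo : ∀ τ, ∀ p < q + 1, φ.lower (y τ) p = x (φ.index τ p) := fun τ p hp => by
    rw [lower, hyd τ _ (by omega)]
    congr 1
    rw [Nat.mul_div_cancel_left _ two_pos]
    omega
  have hup : ∀ τ, ∀ p < q + 1, φ.upper (y τ) p = x (φ.index τ p + 1) := fun τ p hp => by
    rw [upper, hyd τ _ (by omega)]
    congr 1
    rw [show (2 * p + 1) / 2 = p by omega]
    omega
  refine ⟨x, y, hb, hy, fun i hi τ => ⟨?_, ?_, fun p hp => ?_, fun C hC => ?_⟩⟩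
  · rintro rfl; exact h₀
  · rintro rfl; exact h₁
  · rw [hlo τ p hp, hup τ p hp]
    refine ⟨hx _ (by have := hidx τ p; omega), ?_, ?_⟩ <;> rintro rfl <;> rfl
  · obtain ⟨L, hL, hLS⟩ := hsat C hC
    obtain ⟨m, hm, rfl⟩ := List.getElem_of_mem hL
    have hmq : m < q + 1 := by have := φ.width C hC; omega
    refine ⟨m, hm, ?_⟩
    rw [hlo τ m hmq, hup τ m hmq]
    have hj := hidx τ m
    generalize φ.index τ m = j at hj
    generalize C[m] = L at hLS
    obtain ⟨u, b⟩ := L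
    cases b with
    | true =>
        have hu : u ∈ S := by simpa using hLS
        obtain ⟨j', h₂, h₃, h₄⟩ := (hmem u).1 hu
        simp only [Falsified, if_true]
        rw [← h₄]
        rintro ⟨h₅, h₆⟩
        -- A term strictly between consecutive terms would have an index strictly between `j` and `j
        -- + 1`.
        have := lt_of_lt_of_consecutive hx h₅ (by omega)
        have := lt_of_lt_of_consecutive hx h₆ (by omega)
        omega
    | false =>
        have hu : u ∉ S := by simpa using hLS
        simp only [Falsified, Bool.false_eq_true, if_false]
        intro h₂
        refine hu ((hmem u).2 ⟨j, ?_, by omega, h₂⟩)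
        -- Index `0` belongs to the sentinel `0`, which is not a variable.
        by_contra! h₃
        obtain rfl : j = 0 := by omega
        omega

theorem hasWeightedSolution_iff_hasPairedCut :
    φ.HasWeightedSolution ↔ φ.grid.toPairedCut.HasPairedCut := by
  rw [ConstraintGrid.hasPairedCut_toPairedCut_iff]
  simp only [grid, decide_eq_true_eq]
  constructor
  · intro h
    obtain ⟨x, y, hx, hy, hxy⟩ := φ.exists_compatible h
    exact ⟨x, y, fun i _ => hx i, fun τ _ => hy τ, fun i hi τ _ => hxy i hi τ⟩
  · rintro ⟨x, y, -, -, h⟩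
    exact φ.hasWeightedSolution_of_compatible h

end WeightedCNF

/-! ### Derived arithmetic expressions -/

namespace Expr

variable (inp env : List ℕ) (a b c x y : Expr)

/-- Product. -/
def mulE : Expr := bind₂ a b (sum (var 1) (var 1))

@[simp] theorem eval_mulE : (mulE a b).eval inp env = a.eval inp env * b.eval inp env := by
  simp [mulE, eval]

/-- Power with a fixed exponent. -/
def powE : ℕ → Expr
  | 0 => const 1
  | n + 1 => mulE (powE n) a

@[simp] theorem eval_powE (n : ℕ) : (powE a n).eval inp env = a.eval inp env ^ n := by
  induction n with
  | zero => rfl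
  | succ n ih => rw [powE, eval_mulE, ih, pow_succ]

/-- The test `a ≤ b`, with value `0` or `1`. -/
def leE : Expr := sub (const 1) (sub a b)

theorem eval_leE : (leE a b).eval inp env = if a.eval inp env ≤ b.eval inp env then 1 else 0 := by
  simp only [leE, eval]
  split_ifs <;> omega

/-- Quotient. -/
def divE : Expr := bind₂ a b (sum (var 1) (leE (mulE (add (var 0) (const 1)) (var 1)) (var 2)))

/-- The quotient counts the `i < a` with `(i + 1) * b ≤ a`. For `b = 0` this count would be `a`,
hence the hypothesis. -/
theorem eval_divE (h : 0 < b.eval inp env) :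
    (divE a b).eval inp env = a.eval inp env / b.eval inp env := by
  have e : (divE a b).eval inp env = ∑ i ∈ Finset.range (a.eval inp env),
      if i + 1 ≤ a.eval inp env / b.eval inp env then 1 else 0 := by
    simp only [Nat.le_div_iff_mul_le h]
    simp [divE, eval, eval_leE]
  rw [e, Finset.sum_boole]
  have : {i ∈ Finset.range (a.eval inp env) | i + 1 ≤ a.eval inp env / b.eval inp env} =
      Finset.range (a.eval inp env / b.eval inp env) := by
    ext i
    have := Nat.div_le_self (a.eval inp env) (b.eval inp env)
    simp only [Finset.mem_filter, Finset.mem_range]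
    omega
  rw [this, Finset.card_range, Nat.cast_id]

/-- Remainder. -/
def modE : Expr := bind₂ a b (sub (var 1) (mulE (var 0) (divE (var 1) (var 0))))

theorem eval_modE (h : 0 < b.eval inp env) :
    (modE a b).eval inp env = a.eval inp env % b.eval inp env := by
  have h' : 0 < (var 0).eval inp (b.eval inp env :: a.eval inp env :: env) := h
  simp only [modE, eval, eval_mulE]
  rw [eval_divE _ _ _ _ h']
  simp only [eval, List.getD_cons_zero, List.getD_cons_succ]
  have := Nat.div_add_mod (a.eval inp env) (b.eval inp env)
  omega

/-- The value of the expression tells whether the proposition is true. -/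
structure Tests (inp env : List ℕ) (e : Expr) (p : Prop) : Prop where
  pos : p → e.eval inp env = 1
  neg : ¬ p → e.eval inp env = 0

/-- Conditional expression for a test `c`. -/
def iteE : Expr := add (mulE c x) (mulE (sub (const 1) c) y)

variable {inp env a b c x y} {p p' : Prop}

theorem Tests.eval_ite [Decidable p] (h : Tests inp env c p) :
    (iteE c x y).eval inp env = if p then x.eval inp env else y.eval inp env := by
  simp only [iteE, eval, eval_mulE]
  split_ifs with hp
  · simp [h.pos hp]
  · simp [h.neg hp]

theorem Tests.iff (h : Tests inp env c p) (hp : p ↔ p') : Tests inp env c p' :=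
  ⟨fun h' => h.pos (hp.2 h'), fun h' => h.neg fun h'' => h' (hp.1 h'')⟩

theorem tests_le : Tests inp env (leE a b) (a.eval inp env ≤ b.eval inp env) :=
  ⟨fun h => by rw [eval_leE, if_pos h], fun h => by rw [eval_leE, if_neg h]⟩

/-- The test `a < b`. -/
def ltE (a b : Expr) : Expr := leE (add a (const 1)) b

theorem tests_lt : Tests inp env (ltE a b) (a.eval inp env < b.eval inp env) := tests_le

/-- Negation. -/
def notE (c : Expr) : Expr := sub (const 1) c

theorem Tests.not (h : Tests inp env c p) : Tests inp env (notE c) (¬ p) :=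
  ⟨fun hp => by simp [notE, eval, h.neg hp], fun hp => by simp [notE, eval, h.pos (not_not.1 hp)]⟩

theorem Tests.and (h : Tests inp env a p) (h' : Tests inp env b p') :
    Tests inp env (mulE a b) (p ∧ p') := by
  refine ⟨fun hp => by simp [h.pos hp.1, h'.pos hp.2], fun hp => ?_⟩
  by_cases hp₁ : p
  · simp [h'.neg fun hp₂ => hp ⟨hp₁, hp₂⟩]
  · simp [h.neg hp₁]

/-- Implication. -/
def impE (a b : Expr) : Expr := notE (mulE a (notE b))

theorem Tests.imp (h : Tests inp env a p) (h' : Tests inp env b p') :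
    Tests inp env (impE a b) (p → p') :=
  (h.and h'.not).not.iff (by tauto)

/-- The test `a = b`. -/
def eqE (a b : Expr) : Expr := mulE (leE a b) (leE b a)

theorem tests_eq : Tests inp env (eqE a b) (a.eval inp env = b.eval inp env) :=
  (tests_le.and tests_le).iff le_antisymm_iff.symm

/-- Universal quantification below a bound. -/
def allE (n f : Expr) : Expr := sub (const 1) (sum n (notE f))

/-- The sum counts the violations; subtracting it from `1` tells whether there are any. -/
theorem Tests.all {n f : Expr} {P : ℕ → Prop}
    (h : ∀ i < n.eval inp env, Tests inp (i :: env) f (P i)) :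
    Tests inp env (allE n f) (∀ i < n.eval inp env, P i) := by
  constructor
  · intro hP
    have : (sum n (notE f)).eval inp env = 0 :=
      Finset.sum_eq_zero fun i hi =>
        (h i (Finset.mem_range.1 hi)).not.neg (not_not.2 (hP i (Finset.mem_range.1 hi)))
    simp only [allE, eval] at this ⊢
    omega
  · intro hP
    push Not at hP
    obtain ⟨i, hi, hPi⟩ := hP
    have h₁ : (notE f).eval inp (i :: env) ≤ (sum n (notE f)).eval inp env :=
      Finset.single_le_sum (f := fun i => (notE f).eval inp (i :: env)) (fun _ _ => Nat.zero_le _)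
        (Finset.mem_range.2 hi)
    rw [(h i hi).not.pos hPi] at h₁
    simp only [allE, eval] at h₁ ⊢
    omega

theorem Tests.bind₂ {f : Expr} (h : Tests inp (b.eval inp env :: a.eval inp env :: env) f p) :
    Tests inp env (bind₂ a b f) p := ⟨h.pos, h.neg⟩

/-- Conjunction of a fixed number of tests. -/
def bigAndE : ℕ → (ℕ → Expr) → Expr
  | 0, _ => const 1
  | n + 1, f => mulE (bigAndE n f) (f n)

theorem Tests.bigAnd {f : ℕ → Expr} {P : ℕ → Prop} (n : ℕ)
    (h : ∀ i < n, Tests inp env (f i) (P i)) :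
    Tests inp env (bigAndE n f) (∀ i < n, P i) := by
  induction n with
  | zero => exact ⟨fun _ => rfl, fun h => absurd (by simp) h⟩
  | succ n ih =>
      refine ((ih fun i hi => h i (by omega)).and (h n (by omega))).iff ?_
      exact Nat.forall_lt_succ_right.symm

end Expr

/-! ### The program of the reduction -/

namespace WeightedCNF

open Expr

variable {q : ℕ} (φ : WeightedCNF q)

/-- The start of the code of clause `j` in the code of a formula. -/
def clauseStart (j : ℕ) : ℕ := 3 + ((φ.clauses.take j).flatMap (withLength literalCode)).length

theorem toNats_eq_append {j : ℕ} (hj : j < φ.clauses.length) : φ.toNats =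
    (φ.numVars :: φ.weight :: φ.clauses.length ::
      (φ.clauses.take j).flatMap (withLength literalCode)) ++
    (withLength literalCode φ.clauses[j] ++
      (φ.clauses.drop (j + 1)).flatMap (withLength literalCode)) := by
  have h : φ.clauses = φ.clauses.take j ++ φ.clauses[j] :: φ.clauses.drop (j + 1) := by
    rw [← List.drop_eq_getElem_cons hj, List.take_append_drop]
  conv_lhs => rw [toNats, withLength]
  conv_lhs => enter [2, 2, 2]; rw [h]
  simp only [List.flatMap_append, List.flatMap_cons, List.cons_append]

theorem getD_toNats_clauseStart_add {j : ℕ} (hj : j < φ.clauses.length) (r : ℕ) :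
    φ.toNats.getD (φ.clauseStart j + r) 0 =
      (withLength literalCode φ.clauses[j] ++
        (φ.clauses.drop (j + 1)).flatMap (withLength literalCode)).getD r 0 := by
  rw [φ.toNats_eq_append hj, List.getD_append_right]
  · congr 1
    simp only [clauseStart, List.length_cons]
    omega
  · simp only [clauseStart, List.length_cons]
    omega

theorem getD_toNats_length {j : ℕ} (hj : j < φ.clauses.length) :
    φ.toNats.getD (φ.clauseStart j) 0 = φ.clauses[j].length := by
  have := φ.getD_toNats_clauseStart_add hj 0
  simpa [withLength] using this

theorem getD_flatMap_literalCode {n : ℕ} (C : List (Fin n × Bool)) (l : List ℕ) :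
    ∀ (m : ℕ) (hm : m < C.length), (C.flatMap literalCode ++ l).getD (2 * m) 0 = C[m].1 ∧
      (C.flatMap literalCode ++ l).getD (2 * m + 1) 0 = C[m].2.toNat := by
  induction C with
  | nil => intro m hm; simp at hm
  | cons L C ih =>
      intro m hm
      rcases m with _ | m
      · simp [literalCode]
      · have := ih m (by simpa using hm)
        simpa [literalCode, mul_add] using this

theorem getD_toNats_literal {j m : ℕ} (hj : j < φ.clauses.length)
    (hm : m < φ.clauses[j].length) :
    φ.toNats.getD (φ.clauseStart j + (2 * m + 1)) 0 = φ.clauses[j][m].1 ∧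
      φ.toNats.getD (φ.clauseStart j + (2 * m + 2)) 0 = φ.clauses[j][m].2.toNat := by
  rw [φ.getD_toNats_clauseStart_add hj, φ.getD_toNats_clauseStart_add hj]
  simp only [withLength, List.cons_append, List.getD_cons_succ]
  exact getD_flatMap_literalCode _ _ m hm

theorem clauseStart_succ {j : ℕ} (hj : j < φ.clauses.length) :
    φ.clauseStart (j + 1) = φ.clauseStart j + (1 + 2 * φ.clauses[j].length) := by
  have h : ∀ C : List (Fin φ.numVars × Bool), (C.flatMap literalCode).length = 2 * C.length := by
    intro C
    induction C with
    | nil => rfl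
    | cons L C ih => rw [List.flatMap_cons, List.length_append, ih]; simp [literalCode]; omega
  rw [clauseStart, clauseStart, List.take_add_one, List.getElem?_eq_getElem hj, List.flatMap_append,
    List.length_append]
  simp only [Option.toList_some, List.flatMap_cons, List.flatMap_nil, List.append_nil, withLength,
    List.length_cons, h]
  omega

/-- A clause takes one entry for its length and two for each of at most `q` literals. Thus the cap
in `startE` never alters the iteration. -/
theorem clauseStart_le {j : ℕ} (hj : j ≤ φ.clauses.length) :
    φ.clauseStart j ≤ 3 + j * (2 * q + 1) := by
  induction j with
  | zero => simp [clauseStart]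
  | succ j ih =>
      rw [φ.clauseStart_succ hj]
      have h₁ := ih (by omega)
      have h₂ := φ.width _ (List.getElem_mem hj)
      rw [Nat.add_one_mul j]
      omega

/-- The number of variables. -/
def varsE : Expr := look (const 0)

/-- The weight. -/
def weightE : Expr := look (const 1)

/-- The domain size for the elements of the increasing sequence. -/
def domE : Expr := add varsE (const 2)

/-- The number of possible indices of an element and its successor. -/
def idxE : Expr := add weightE (const 1)

/-- The position of a clause in the input. -/
def startE (q : ℕ) (c : Expr) : Expr :=
  iter c (add (const 3) (mulE c (const (2 * q + 1)))) (const 3)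
    (add (var 0) (add (const 1) (mulE (const 2) (look (var 0)))))

variable (env : List ℕ)

@[simp] theorem eval_varsE : varsE.eval φ.toNats env = φ.numVars := by
  simp [varsE, eval, toNats]

@[simp] theorem eval_weightE : weightE.eval φ.toNats env = φ.weight := by
  simp [weightE, eval, toNats]

@[simp] theorem eval_domE : domE.eval φ.toNats env = φ.numVars + 2 := by
  simp [domE, eval]

@[simp] theorem eval_idxE : idxE.eval φ.toNats env = φ.weight + 1 := by
  simp [idxE, eval]

theorem eval_startE {c : Expr} (hc : c.eval φ.toNats env < φ.clauses.length) :
    (startE q c).eval φ.toNats env = φ.clauseStart (c.eval φ.toNats env) := by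
  simp only [startE, eval, eval_mulE, List.getD_cons_zero]
  set j := c.eval φ.toNats env
  have key : ∀ i ≤ j, (fun x => x + (1 + 2 * φ.toNats.getD x 0) -
      (x + (1 + 2 * φ.toNats.getD x 0) - (3 + j * (2 * q + 1))))^[i] 3 = φ.clauseStart i := by
    intro i
    induction i with
    | zero => intro _; simp [clauseStart]
    | succ i ih =>
        intro hi
        have hi' : i < φ.clauses.length := by omega
        rw [Function.iterate_succ_apply', ih (by omega), φ.getD_toNats_length hi',
          ← φ.clauseStart_succ hi']
        have h₁ := φ.clauseStart_le (show i + 1 ≤ φ.clauses.length by omega)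
        have h₂ : (i + 1) * (2 * q + 1) ≤ j * (2 * q + 1) := Nat.mul_le_mul_right _ hi
        omega
  exact key j le_rfl

/-- Component `r` of the list of values that is coded by variable `d`. -/
def digitE (d r : ℕ) : Expr := modE (divE (var d) (powE domE r)) domE

theorem eval_digitE (d r : ℕ) : (digitE d r).eval φ.toNats env =
    env.getD d 0 / (φ.numVars + 2) ^ r % (φ.numVars + 2) := by
  rw [digitE, eval_modE _ _ _ _ (by simp), eval_divE _ _ _ _ (by simp)]
  simp [eval]

/-- Component `r` of the list of indices that is coded by variable `d`. -/
def indexE (d r : ℕ) : Expr := modE (divE (var d) (powE idxE r)) idxE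

theorem eval_indexE (d r : ℕ) : (indexE d r).eval φ.toNats env = φ.index (env.getD d 0) r := by
  rw [indexE, eval_modE _ _ _ _ (by simp), eval_divE _ _ _ _ (by simp)]
  simp [eval, index]

/-- The test whether literal `m` of a clause is falsified; variable `1` is the start of the clause
and variable `3` codes the values. -/
def falsifiedE (m : ℕ) : Expr :=
  let u := add (look (add (var 1) (const (2 * m + 1)))) (const 1)
  let b := look (add (var 1) (const (2 * m + 2)))
  -- A disjunction of the cases of a positive and a negative literal, by De Morgan.
  notE (mulE (notE (mulE b (mulE (ltE (digitE 3 (2 * m)) u) (ltE u (digitE 3 (2 * m + 1))))))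
    (notE (mulE (notE b) (eqE (digitE 3 (2 * m)) u))))

theorem tests_falsifiedE {j m w z : ℕ} (hj : j < φ.clauses.length)
    (hm : m < φ.clauses[j].length) :
    Tests φ.toNats (z :: φ.clauseStart j :: j :: w :: env) (falsifiedE m)
      (Falsified φ.clauses[j][m] (φ.lower w m) (φ.upper w m)) := by
  obtain ⟨h₁, h₂⟩ := φ.getD_toNats_literal hj hm
  have hb : Tests φ.toNats (z :: φ.clauseStart j :: j :: w :: env)
      (look (add (var 1) (const (2 * m + 2)))) (φ.clauses[j][m].2 = true) := by
    constructor <;> intro h <;> simp only [eval, List.getD_cons_succ, List.getD_cons_zero, h₂]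
    · rw [h]; rfl
    · rw [Bool.not_eq_true] at h; rw [h]; rfl
  refine ((hb.and (tests_lt.and tests_lt)).not.and (hb.not.and tests_eq).not).not.iff ?_
  simp only [eval, eval_digitE, List.getD_cons_succ, List.getD_cons_zero, h₁, lower, upper,
    Falsified]
  split_ifs with h <;> simp [h]

/-- The test for compatibility; the variables are, in this order, `w`, `v`, `τ` and `i`. -/
def compatBodyE (q : ℕ) : Expr :=
  mulE (impE (eqE (var 3) (const 0)) (eqE (var 1) (const 0)))
    (mulE (impE (eqE (var 3) idxE) (eqE (var 1) (add varsE (const 1))))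
      (mulE (bigAndE (q + 1) fun p => mulE (ltE (digitE 0 (2 * p)) (digitE 0 (2 * p + 1)))
          (mulE (impE (eqE (indexE 2 p) (var 3)) (eqE (digitE 0 (2 * p)) (var 1)))
            (impE (eqE (add (indexE 2 p) (const 1)) (var 3)) (eqE (digitE 0 (2 * p + 1)) (var 1)))))
        -- Entry `2` of the input is the number of clauses. The start of the clause becomes variable
        -- `1`; the constant `0` is only a dummy.
        (allE (look (const 2)) (bind₂ (startE q (var 0)) (const 0)
          (notE (bigAndE q fun m => notE (mulE (ltE (const m) (look (var 1)))
            (notE (falsifiedE m)))))))))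

theorem tests_compatBodyE (i τ v w : ℕ) :
    Tests φ.toNats (w :: v :: τ :: i :: env) (compatBodyE q) (φ.Compatible i τ v w) := by
  have hlen : (look (const 2)).eval φ.toNats (w :: v :: τ :: i :: env) = φ.clauses.length := by
    simp [eval, toNats, withLength]
  have hall : Tests φ.toNats (w :: v :: τ :: i :: env)
      (allE (look (const 2)) (Expr.bind₂ (startE q (var 0)) (const 0)
          (notE (bigAndE q fun m => notE (mulE (ltE (const m) (look (var 1)))
            (notE (falsifiedE m)))))))
      (∀ C ∈ φ.clauses, ∃ (m : ℕ) (h : m < C.length),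
        ¬ Falsified C[m] (φ.lower w m) (φ.upper w m)) := by
    refine (Tests.all (P := fun j => ∀ hj : j < φ.clauses.length,
      ¬ ∀ m < q, ¬ ∃ h : m < φ.clauses[j].length,
        ¬ Falsified φ.clauses[j][m] (φ.lower w m) (φ.upper w m)) fun j hj => ?_).iff ?_
    · rw [hlen] at hj
      refine Tests.bind₂ ?_
      rw [φ.eval_startE (c := var 0) (j :: w :: v :: τ :: i :: env) hj]
      refine (Tests.not (Tests.bigAnd _ fun m hm => Tests.not
        (p := ∃ h : m < φ.clauses[j].length,
          ¬ Falsified φ.clauses[j][m] (φ.lower w m) (φ.upper w m)) ?_)).iff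
          ⟨fun h _ => h, fun h => h hj⟩
      have hl : (look (var 1)).eval φ.toNats ((const 0).eval φ.toNats
          (j :: w :: v :: τ :: i :: env) :: φ.clauseStart j :: j :: w :: v :: τ :: i :: env) =
          φ.clauses[j].length := φ.getD_toNats_length hj
      by_cases hmC : m < φ.clauses[j].length
      · refine (tests_lt.and (φ.tests_falsifiedE (v :: τ :: i :: env) hj hmC).not).iff ?_
        rw [hl]
        exact ⟨fun h => ⟨h.1, h.2⟩, fun h => ⟨h.1, h.2⟩⟩
      -- Behind the end of the clause the literal test reads unrelated entries, but the length test
      -- makes the product `0`.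
      · refine ⟨fun h => absurd h.1 hmC, fun _ => ?_⟩
        exact (eval_mulE _ _ _ _).trans (mul_eq_zero_of_left
          ((tests_lt (a := const m)).neg fun h => hmC (h.trans_eq hl)) _)
    · rw [hlen]
      constructor
      · intro h C hC
        obtain ⟨j, hj, rfl⟩ := List.getElem_of_mem hC
        have := h j hj hj
        push Not at this
        obtain ⟨m, -, h₁, h₂⟩ := this
        exact ⟨m, h₁, h₂⟩
      · intro h j hj _ hn
        obtain ⟨m, h₁, h₂⟩ := h _ (List.getElem_mem hj)
        exact hn m (h₁.trans_le (φ.width _ (List.getElem_mem hj))) ⟨h₁, h₂⟩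
  refine ((tests_eq.imp tests_eq).and ((tests_eq.imp tests_eq).and ((Tests.bigAnd _ fun p _ =>
    tests_lt.and ((tests_eq.imp tests_eq).and (tests_eq.imp tests_eq))).and hall))).iff ?_
  simp only [eval, eval_digitE, eval_indexE, eval_idxE, eval_varsE, List.getD_cons_succ,
    List.getD_cons_zero, lower, upper, Compatible]

/-- The test for compatibility; `v` and `w` are evaluated with two new variables. -/
def compatE (q : ℕ) (i τ v w : Expr) : Expr := bind₂ i τ (bind₂ v w (compatBodyE q))

end WeightedCNF

/-! ### The grid and its cut instance as expressions -/

namespace WeightedCNF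

open Expr

variable {q : ℕ} (φ : WeightedCNF q) (env : List ℕ)

/-- The number `nT` of the constraint grid. -/
def typesE (q : ℕ) : Expr := powE idxE (q + 1)

/-- The number `nW` of the constraint grid. -/
def valuesE (q : ℕ) : Expr := powE domE (2 * (q + 1))

/-- Half of the number of paths. -/
def ellE (q : ℕ) : Expr := mulE (add weightE (const 2)) (typesE q)

/-- The length of the paths. -/
def lenE (q : ℕ) : Expr := mulE (const 2) (mulE domE (valuesE q))

@[simp] theorem eval_typesE : (typesE q).eval φ.toNats env = φ.grid.nT := by
  simp [typesE, grid]

@[simp] theorem eval_valuesE : (valuesE q).eval φ.toNats env = φ.grid.nW := by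
  simp [valuesE, grid]

@[simp] theorem eval_domE_grid : domE.eval φ.toNats env = φ.grid.nV := φ.eval_domE env

@[simp] theorem eval_ellE : (ellE q).eval φ.toNats env = φ.grid.system.ℓ := by
  simp [ellE, eval, grid, ConstraintGrid.system]

@[simp] theorem eval_lenE : (lenE q).eval φ.toNats env = φ.grid.system.len := by
  simp [lenE, eval, grid, ConstraintGrid.system]

/-- The segment length of the path `x`. -/
def segE (q : ℕ) (x : Expr) : Expr :=
  iteE (ltE x (ellE q)) (mulE (const 2) (valuesE q)) (mulE (const 2) domE)

theorem eval_segE (x : Expr) : (segE q x).eval φ.toNats env =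
    φ.grid.system.seg (x.eval φ.toNats env) := by
  rw [segE, tests_lt.eval_ite]
  simp only [eval, eval_mulE, eval_ellE, eval_valuesE, eval_domE_grid]
  rfl

/-- The representative of the path `x`. -/
def repE (q : ℕ) (x : Expr) : Expr :=
  iteE (ltE x (ellE q)) (mulE (divE x (typesE q)) (typesE q))
    (add (ellE q) (modE (sub x (ellE q)) (typesE q)))

theorem eval_repE (x : Expr) : (repE q x).eval φ.toNats env =
    φ.grid.system.rep (x.eval φ.toNats env) := by
  have h : 0 < (typesE q).eval φ.toNats env := by simpa using φ.grid.nT_pos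
  rw [repE, tests_lt.eval_ite]
  simp only [eval, eval_mulE, eval_divE _ _ _ _ h, eval_modE _ _ _ _ h, eval_ellE, eval_typesE]
  rfl

/-- The vertex at position `p` of the path `x`. -/
def vertexE (q : ℕ) (x p : Expr) : Expr :=
  iteE (eqE p (const 0)) (const 0) (iteE (eqE p (lenE q)) (const 1)
    (iteE (eqE (modE p (segE q x)) (const 0)) (add (const 2) (add (mulE (repE q x) (lenE q)) p))
      (add (const 2) (add (mulE x (lenE q)) p))))

theorem eval_vertexE (x p : Expr) : (vertexE q x p).eval φ.toNats env =
    φ.grid.system.vertex (x.eval φ.toNats env) (p.eval φ.toNats env) := by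
  have h : 0 < (segE q x).eval φ.toNats env := by
    rw [eval_segE]; exact φ.grid.system.seg_pos _
  rw [vertexE, tests_eq.eval_ite, tests_eq.eval_ite, tests_eq.eval_ite]
  simp only [eval, eval_mulE, eval_modE _ _ _ _ h, eval_segE, eval_repE, eval_lenE]
  rfl

theorem tests_compatE (i τ v w : Expr) {v' w' : ℕ}
    (hv : v.eval φ.toNats (τ.eval φ.toNats env :: i.eval φ.toNats env :: env) = v')
    (hw : w.eval φ.toNats (τ.eval φ.toNats env :: i.eval φ.toNats env :: env) = w') :
    Tests φ.toNats env (compatE q i τ v w)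
      (φ.grid.compat (i.eval φ.toNats env) (τ.eval φ.toNats env) v' w' = true) := by
  subst hv hw
  refine (Tests.bind₂ (Tests.bind₂ (φ.tests_compatBodyE env _ _ _ _))).iff ?_
  simp [grid]

/-- The arc that is paired with arc `a`; the variables are, in this order, the position of `a`
divided by two, the path of `a`, and `a`. -/
def mateBodyE (q : ℕ) : Expr :=
  let ρ := sub (var 1) (ellE q)
  let a₂ := modE (var 2) (const 2)
  let stay := add (mulE (var 1) (lenE q)) (add (mulE (const 2) (var 0)) (sub (const 1) a₂))
  iteE (ltE (var 1) (ellE q))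
    (iteE (compatE q (divE (var 1) (typesE q)) (modE (var 1) (typesE q))
        -- Below the two variables bound by `compatE`, the halved position `var 0` has become `var
        -- 2`.
        (divE (var 2) (valuesE q)) (modE (var 2) (valuesE q)))
      (add (mulE (add (var 1) (ellE q)) (lenE q)) (add (mulE (const 2)
        (add (mulE (modE (var 0) (valuesE q)) domE) (divE (var 0) (valuesE q)))) a₂))
      stay)
    (iteE (compatE q (divE ρ (typesE q)) (modE ρ (typesE q))
        (modE (var 2) domE) (divE (var 2) domE))
      (add (mulE ρ (lenE q)) (add (mulE (const 2)
        (add (mulE (modE (var 0) domE) (valuesE q)) (divE (var 0) domE))) a₂))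
      stay)

/-- The arc that is paired with the arc given by variable `0`. -/
def mateE (q : ℕ) : Expr :=
  bind₂ (divE (var 0) (lenE q)) (divE (modE (var 0) (lenE q)) (const 2)) (mateBodyE q)

theorem eval_mateE (a : ℕ) : (mateE q).eval φ.toNats (a :: env) = φ.grid.mateNat a := by
  have hT : ∀ env, 0 < (typesE q).eval φ.toNats env := fun env => by simpa using φ.grid.nT_pos
  have hW : ∀ env, 0 < (valuesE q).eval φ.toNats env := fun env => by simpa using φ.grid.nW_pos
  have hV : ∀ env, 0 < domE.eval φ.toNats env := fun env => by simp
  have hl : ∀ env, 0 < (lenE q).eval φ.toNats env := fun env => by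
    simpa using φ.grid.system.len_pos
  have h₂ : ∀ env, 0 < (const 2).eval φ.toNats env := fun env => two_pos
  simp only [mateE, eval, eval_divE _ _ _ _ (hl _), eval_modE _ _ _ _ (hl _),
    eval_divE _ _ _ _ (h₂ _), List.getD_cons_zero, eval_lenE]
  rw [mateBodyE, tests_lt.eval_ite,
    (φ.tests_compatE _ _ _ _ _ (eval_divE _ _ _ _ (hW _)) (eval_modE _ _ _ _ (hW _))).eval_ite,
    (φ.tests_compatE _ _ _ _ _ (eval_modE _ _ _ _ (hV _)) (eval_divE _ _ _ _ (hV _))).eval_ite]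
  simp only [eval, eval_mulE, eval_divE _ _ _ _ (hT _), eval_modE _ _ _ _ (hT _),
    eval_divE _ _ _ _ (hW _), eval_modE _ _ _ _ (hW _), eval_divE _ _ _ _ (hV _),
    eval_modE _ _ _ _ (hV _), eval_modE _ _ _ _ (h₂ _), eval_ellE, eval_lenE, eval_typesE,
    eval_valuesE, eval_domE_grid, List.getD_cons_zero, List.getD_cons_succ]
  rfl

/-- The reduction as a program. -/
def reductionProg (q : ℕ) : ListProg :=
  let m := mulE (mulE (const 2) (ellE q)) (lenE q)
  let x := divE (var 0) (lenE q)
  let p := modE (var 0) (lenE q)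
  .seq (.emit (add (const 2) m)) <| .seq (.emit m) <| .seq (.emit (const 0)) <|
  .seq (.emit (const 1)) <| .seq (.emit (ellE q)) <|
  .seq (.forRange m (.emit (vertexE q x p))) <|
  .seq (.forRange m (.emit (vertexE q x (add p (const 1))))) <|
  .seq (.forRange m (.emit (mateE q))) <|
  .forRange (mulE (const 2) (ellE q)) <| .seq (.emit (lenE q)) <|
  .forRange (lenE q) (.emit (add (mulE (var 1) (lenE q)) (var 0)))

theorem flatMap_ofFn {α : Type} {n : ℕ} (f : Fin n → α) (code : α → List ℕ) (F : ℕ → List ℕ)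
    (h : ∀ i : Fin n, code (f i) = F i) :
    (List.ofFn f).flatMap code = (List.range n).flatMap F := by
  rw [List.ofFn_eq_map, List.flatMap_map, ← List.map_coe_finRange_eq_range, List.flatMap_map]
  exact congrArg (fun g => (List.finRange n).flatMap g) (funext h)

/-- Arc `π * len + p` reveals its path and position by division, so every list of the instance is
given by a formula in the running index. -/
theorem eval_reductionProg : (reductionProg q).eval φ.toNats [] = φ.grid.toPairedCut.toNats := by
  have hl : ∀ env, 0 < (lenE q).eval φ.toNats env := fun env => by
    simpa using φ.grid.system.len_pos
  have e₁ := flatMap_ofFn φ.grid.toPairedCut.graph.src finCode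
    (fun a => [φ.grid.system.vertex (a / φ.grid.system.len) (a % φ.grid.system.len)])
    fun _ => rfl
  have e₂ := flatMap_ofFn φ.grid.toPairedCut.graph.tgt finCode
    (fun a => [φ.grid.system.vertex (a / φ.grid.system.len) (a % φ.grid.system.len + 1)])
    fun _ => rfl
  have e₃ := flatMap_ofFn φ.grid.toPairedCut.mate finCode
    (fun a => [φ.grid.mateNat a]) fun _ => rfl
  have e₄ := flatMap_ofFn φ.grid.toPairedCut.path (withLength finCode)
    (fun π => φ.grid.system.len :: (List.range φ.grid.system.len).flatMap fun p =>
      [π * φ.grid.system.len + p]) fun π => by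
    have := flatMap_ofFn (fun j => φ.grid.system.arc π j π.2 j.2) finCode
      (fun p => [π * φ.grid.system.len + p]) fun _ => rfl
    exact congrArg₂ List.cons List.length_ofFn this
  rw [PairedCutInstance.toNats, e₁, e₂, e₃, e₄]
  simp only [reductionProg, ListProg.eval, eval, eval_mulE, eval_ellE, eval_lenE, eval_vertexE,
    eval_mateE, eval_divE _ _ _ _ (hl _), eval_modE _ _ _ _ (hl _), List.getD_cons_zero,
    List.getD_cons_succ]
  rfl

end WeightedCNF

theorem mainTheorem7 : W1Hard pairedMinCutProblem := by
  rintro P ⟨q, h⟩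
  refine h.trans_listProg (Q := weightedCNFProblem q) (R := pairedMinCutProblem) rfl rfl
    WeightedCNF.toNats PairedCutInstance.toNats (fun x => List.map_id _) (fun x => List.map_id _)
    (fun φ : WeightedCNF q => φ.grid.toPairedCut) (WeightedCNF.reductionProg q)
    (fun φ => φ.eval_reductionProg) (fun φ => φ.hasWeightedSolution_iff_hasPairedCut)
    -- The number of constraints, which equals `ℓ` and does not involve the number of variables.
    (fun k => (k + 2) * (k + 1) ^ (q + 1)) ?_ ?_ fun φ => le_rfl
  · exact (Computable.id.nat_add (Computable.const 2)).nat_mul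
      ((Computable.id.nat_add (Computable.const 1)).nat_pow_const _)
  · intro a b hab
    dsimp only
    gcongr
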